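/- Let $\mathcal S^n$ be the space of real symmetric $n\times n$ matrices with the trace inner product $\langle\cdot,\cdot\rangle$ and Frobenius norm, and let $\mathcal S^n_+$, $\mathcal S^n_{++}$ be the cones of positive semidefinite and positive definite matrices. Let $\mathcal Q:\mathcal S^n\to\mathcal S^n$ be a self-adjoint positive semidefinite linear operator, $\mathcal A:\mathcal S^n\to\mathbb R^m$ a linear map with adjoint $\mathcal A^*$, $C\in\mathcal S^n$, $b\in\mathbb R^m$, and let $\mathcal K\subseteq\mathcal S^n$ be a nonempty closed convex polyhedral set. Write $\delta_D$ for the indicator function of a set $D$ ($0$ on $D$, $+\infty$ elsewhere), $\delta_{\mathcal K}^*(Z)=\sup_{X\in\mathcal K}\langle Z,X\rangle$ for the conjugate of $\delta_{\mathcal K}$, and $\mathrm{dom}(\delta^*_{\mathcal K})=\{Z:\delta^*_{\mathcal K}(Z)<+\infty\}$. Consider $$(\mathbf P)\quad \min\Big\{\tfrac12\langle X,\mathcal QX\rangle+\langle C,X\rangle \;\Big|\; \mathcal AX=b,\ X\in\mathcal S^n_+\cap\mathcal K\Big\}$$ and its dual, in minimization form and with $W$ restricted to $\mathrm{Range}(\mathcal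 Q)$, $$(\mathbf D)\quad \min\Big\{\delta_{\mathcal K}^*(-Z)+\tfrac12\langle W,\mathcal QW\rangle-\langle b,y\rangle \;\Big|\; Z-\mathcal QW+S+\mathcal A^*y=C,\ Z\in\mathcal S^n,\ S\in\mathcal S^n_+,\ W\in\mathrm{Range}(\mathcal Q),\ y\in\mathbb R^m\Big\}.$$ For $\sigma>0$ put $R(Z,W,S,y)=Z-\mathcal QW+S+\mathcal A^*y-C$ and $$\mathcal L_\sigma(Z,W,S,y;X)=\delta_{\mathcal K}^*(-Z)+\tfrac12\langle W,\mathcal QW\rangle+\delta_{\mathcal S^n_+}(S)-\langle b,y\rangle+\langle R(Z,W,S,y),X\rangle+\tfrac\sigma2\|R(Z,W,S,y)\|^2 .$$ Algorithm (Schur-complement-based inexact semi-proximal ADMM). Let $\sigma>0$, $\tau>0$, and let $\{\varepsilon_k\}$ be a summable sequence of nonnegative numbers. Start from $(W^0,S^0,y^0,X^0)\in\mathrm{Range}(\mathcal Q)\times\mathcal S^n_+\times\mathbb R^m\times\mathcal S^n$ and $-Z^0\in\mathrm{dom}(\delta^*_{\mathcal K})$. For $k=0,1,\dots$ compute $$\begin{aligned}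 \widehat W^k&=\arg\min\{\mathcal L_\sigma(Z^k,W,S^k,y^k;X^k)-\langle\hat\delta^k_{\mathcal Q},W\rangle\mid W\in\mathrm{Range}(\mathcal Q)\},\\ Z^{k+1}&=\arg\min\{\mathcal L_\sigma(Z,\widehat W^k,S^k,y^k;X^k)\mid Z\in\mathcal S^n\},\\ W^{k+1}&=\arg\min\{\mathcal L_\sigma(Z^{k+1},W,S^k,y^k;X^k)-\langle\delta^k_{\mathcal Q},W\rangle\mid W\in\mathrm{Range}(\mathcal Q)\},\\ \hat y^k&=\arg\min\{\mathcal L_\sigma(Z^{k+1},W^{k+1},S^k,y;X^k)-\langle\hat\delta^k_y,y\rangle\mid y\in\mathbb R^m\},\\ S^{k+1}&=\arg\min\{\mathcal L_\sigma(Z^{k+1},W^{k+1},S,\hat y^k;X^k)\mid S\in\mathcal S^n\},\\ y^{k+1}&=\arg\min\{\mathcal L_\sigma(Z^{k+1},W^{k+1},S^{k+1},y;X^k)-\langle\delta^k_y,y\rangle\mid y\in\mathbb R^m\},\\ X^{k+1}&=X^k+\tau\sigma\,R(Z^{k+1},W^{k+1},S^{k+1},y^{k+1}), \end{aligned}$$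 where $\delta^k_y,\hat\delta^k_y\in\mathbb R^m$ and $\delta^k_{\mathcal Q},\hat\delta^k_{\mathcal Q}\in\mathrm{Range}(\mathcal Q)$ are any error vectors with $\max\{\|\delta_y^k\|,\|\hat\delta_y^k\|,\|\delta_{\mathcal Q}^k\|,\|\hat\delta_{\mathcal Q}^k\|\}\le\varepsilon_k$. Theorem. Suppose that the solution set of $(\mathbf P)$ is nonempty and that there is $\widehat X\in\mathcal S^n_{++}\cap\mathrm{ri}(\mathcal K)$ with $\mathcal A\widehat X=b$ and $\mathcal A(\mathcal T_{\mathcal K}(\widehat X))=\mathbb R^m$, where $\mathrm{ri}(\mathcal K)$ is the relative interior of $\mathcal K$ and $\mathcal T_{\mathcal K}(\widehat X)$ the tangent cone of $\mathcal K$ at $\widehat X$. Let $\{(Z^k,W^k,S^k,y^k,X^k)\}$ be any sequence generated by the algorithm. If $\tau\in(0,(1+\sqrt5)/2)$, then $\{(Z^k,W^k,S^k,y^k)\}$ converges to an optimal solution of $(\mathbf D)$ and $\{X^k\}$ converges to an optimal solution of $(\mathbf P)$. -/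

import Mathlib

open Filter Topology
open scoped InnerProductSpace

/-- The subspace of symmetric real `n × n` matrices. -/
def symMatrixSubmodule (n : ℕ) : Submodule ℝ (Matrix (Fin n) (Fin n) ℝ) where
  carrier := {A | A.IsSymm}
  add_mem' ha hb := Matrix.IsSymm.add ha hb
  zero_mem' := Matrix.isSymm_zero
  smul_mem' c _ ha := Matrix.IsSymm.smul ha c

/-- The space of symmetric real `n × n` matrices. It is a separate type so that its norm and
topology are those of the trace inner product below. -/
def SymMat (n : ℕ) : Type := symMatrixSubmodule n

namespace SymMat

variable {n : ℕ}

noncomputable instance : AddCommGroup (SymMat n) :=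
  inferInstanceAs (AddCommGroup (symMatrixSubmodule n))

noncomputable instance : Module ℝ (SymMat n) :=
  inferInstanceAs (Module ℝ (symMatrixSubmodule n))

instance : FiniteDimensional ℝ (SymMat n) :=
  inferInstanceAs (FiniteDimensional ℝ (symMatrixSubmodule n))

/-- The underlying matrix. -/
def mat (X : SymMat n) : Matrix (Fin n) (Fin n) ℝ := (show symMatrixSubmodule n from X).1

theorem mat_isSymm (X : SymMat n) : X.mat.IsSymm := (show symMatrixSubmodule n from X).2

theorem mat_add (X Y : SymMat n) : (X + Y).mat = X.mat + Y.mat := rfl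

theorem mat_smul (c : ℝ) (X : SymMat n) : (c • X).mat = c • X.mat := rfl

theorem mat_zero : (0 : SymMat n).mat = 0 := rfl

theorem mat_injective : Function.Injective (mat : SymMat n → _) := Subtype.coe_injective

theorem trace_mul_self (X : SymMat n) :
    (X.mat * X.mat).trace = ∑ i, ∑ j, X.mat i j ^ 2 := by
  simp only [Matrix.trace, Matrix.diag, Matrix.mul_apply]
  refine Finset.sum_congr rfl fun i _ => Finset.sum_congr rfl fun j _ => ?_
  rw [X.mat_isSymm.apply i j, sq]

/-- The trace inner product `⟪X, Y⟫ = tr (X Y)`. -/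
@[reducible]
noncomputable def innerCore (n : ℕ) : InnerProductSpace.Core ℝ (SymMat n) where
  inner X Y := (X.mat * Y.mat).trace
  conj_inner_symm X Y := by simpa using Matrix.trace_mul_comm Y.mat X.mat
  re_inner_nonneg X := by
    change 0 ≤ (X.mat * X.mat).trace
    rw [trace_mul_self]
    positivity
  add_left X Y Z := by simp [mat_add, add_mul]
  smul_left X Y c := by simp [mat_smul]
  definite X h := by
    change (X.mat * X.mat).trace = 0 at h
    rw [trace_mul_self, Finset.sum_eq_zero_iff_of_nonneg (fun _ _ => by positivity)] at h
    apply mat_injective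
    ext i j
    have h1 := h i (Finset.mem_univ i)
    rw [Finset.sum_eq_zero_iff_of_nonneg (fun _ _ => by positivity)] at h1
    simpa [mat_zero] using h1 j (Finset.mem_univ j)

/-- The Frobenius norm, i.e. the norm of the trace inner product. -/
noncomputable instance : NormedAddCommGroup (SymMat n) :=
  @InnerProductSpace.Core.toNormedAddCommGroup ℝ _ _ _ _ (innerCore n)

noncomputable instance : InnerProductSpace ℝ (SymMat n) :=
  InnerProductSpace.ofCore (innerCore n).toCore

theorem inner_def (X Y : SymMat n) : ⟪X, Y⟫_ℝ = (X.mat * Y.mat).trace := rfl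

end SymMat

/-- The cone of positive semidefinite matrices. -/
def psdCone (n : ℕ) : Set (SymMat n) := {X | X.mat.PosSemidef}

/-- The cone of positive definite matrices. -/
def pdCone (n : ℕ) : Set (SymMat n) := {X | X.mat.PosDef}

section ConvexAnalysis

variable {E : Type*}

open Classical in
/-- The indicator function of `D`: `0` on `D` and `+∞` off `D`. -/
noncomputable def indicatorFn (D : Set E) (x : E) : EReal := if x ∈ D then 0 else ⊤

/-- The Fenchel conjugate `θ* z = sup_x (⟪z, x⟫ - θ x)`. -/
noncomputable def fenchelConj [NormedAddCommGroup E] [InnerProductSpace ℝ E]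
    (θ : E → EReal) (z : E) : EReal := ⨆ x : E, ((⟪z, x⟫_ℝ : ℝ) : EReal) - θ x

/-- The effective domain of an extended-real-valued function. -/
def effDom (θ : E → EReal) : Set E := {x | θ x < ⊤}

/-- `x` is a minimizer of `θ` over `D`. -/
def IsArgmin (θ : E → EReal) (D : Set E) (x : E) : Prop := x ∈ D ∧ IsMinOn θ D x

/-- A convex polyhedral set: a finite intersection of closed half-spaces. -/
def IsPolyhedral [NormedAddCommGroup E] [InnerProductSpace ℝ E] (K : Set E) : Prop :=
  ∃ (p : ℕ) (a : Fin p → E) (c : Fin p → ℝ), K = {x | ∀ i, ⟪a i, x⟫_ℝ ≤ c i}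

end ConvexAnalysis

/-- The data of a convex quadratic semidefinite program
`min { ½⟪X, Q X⟫ + ⟪C, X⟫ | A X = b, X ∈ psdCone n ∩ K }`. -/
structure QSDP (n m : ℕ) where
  Q : SymMat n →ₗ[ℝ] SymMat n
  A : SymMat n →ₗ[ℝ] EuclideanSpace ℝ (Fin m)
  C : SymMat n
  b : EuclideanSpace ℝ (Fin m)
  K : Set (SymMat n)
  /-- `Q` is self-adjoint and positive semidefinite. -/
  Q_pos : Q.IsPositive
  K_nonempty : K.Nonempty
  K_polyhedral : IsPolyhedral K

namespace QSDP

variable {n m : ℕ} (P : QSDP n m)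

/-- The adjoint of `A`. -/
noncomputable def Aadj : EuclideanSpace ℝ (Fin m) →ₗ[ℝ] SymMat n := LinearMap.adjoint P.A

/-- The range of `Q`, as a set. -/
def rangeQ : Set (SymMat n) := (LinearMap.range P.Q : Set (SymMat n))

/-- The primal feasible set. -/
def primalFeasible : Set (SymMat n) := {X | P.A X = P.b ∧ X ∈ psdCone n ∩ P.K}

/-- The primal objective. -/
noncomputable def primalObj (X : SymMat n) : ℝ := (1 / 2) * ⟪X, P.Q X⟫_ℝ + ⟪P.C, X⟫_ℝ

/-- The set of optimal solutions of the primal problem. -/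
def primalSolutions : Set (SymMat n) :=
  {X | X ∈ P.primalFeasible ∧ ∀ X' ∈ P.primalFeasible, P.primalObj X ≤ P.primalObj X'}

/-- The support function of `K`, i.e. the conjugate of its indicator function. -/
noncomputable def suppK : SymMat n → EReal := fenchelConj (indicatorFn P.K)

/-- The residual `Z - Q W + S + A* y - C` of the dual equality constraint. -/
noncomputable def residual (Z W S : SymMat n) (y : EuclideanSpace ℝ (Fin m)) : SymMat n :=
  Z - P.Q W + S + P.Aadj y - P.C

/-- The dual objective (in minimization form) at `(Z, W, S, y)`; it does not depend on `S`. -/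
noncomputable def dualObj
    (v : SymMat n × SymMat n × SymMat n × EuclideanSpace ℝ (Fin m)) : EReal :=
  match v with
  | (Z, W, _S, y) => P.suppK (-Z) + (((1 / 2) * ⟪W, P.Q W⟫_ℝ - ⟪P.b, y⟫_ℝ : ℝ) : EReal)

/-- The feasible set of the dual problem, with `W` restricted to the range of `Q`:
`Z - Q W + S + A* y = C`, `S` positive semidefinite, `W ∈ Range Q`. -/
def dualFeasible : Set (SymMat n × SymMat n × SymMat n × EuclideanSpace ℝ (Fin m)) :=
  {v | match v with
    | (Z, W, S, y) => Z - P.Q W + S + P.Aadj y = P.C ∧ S ∈ psdCone n ∧ W ∈ P.rangeQ}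

/-- The set of optimal solutions of the dual problem: feasible points with finite objective value
that minimize the objective over the feasible set. -/
def dualSolutions : Set (SymMat n × SymMat n × SymMat n × EuclideanSpace ℝ (Fin m)) :=
  {v | v ∈ effDom P.dualObj ∧ IsArgmin P.dualObj P.dualFeasible v}

/-- The Lagrangian of the dual problem. -/
noncomputable def lagrangian (Z W S : SymMat n) (y : EuclideanSpace ℝ (Fin m)) (X : SymMat n) :
    EReal :=
  P.suppK (-Z) + indicatorFn (psdCone n) S
    + (((1 / 2) * ⟪W, P.Q W⟫_ℝ - ⟪P.b, y⟫_ℝ + ⟪P.residual Z W S y, X⟫_ℝ : ℝ) : EReal)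

/-- The augmented Lagrangian of the dual problem with penalty parameter `σ`. -/
noncomputable def augLagrangian (σ : ℝ) (Z W S : SymMat n) (y : EuclideanSpace ℝ (Fin m))
    (X : SymMat n) : EReal :=
  P.lagrangian Z W S y X + ((σ / 2 * ‖P.residual Z W S y‖ ^ 2 : ℝ) : EReal)

/-- The Slater-type constraint qualification: there is a feasible point `X` of the primal problem
that is positive definite and lies in the relative interior of `K`, such that `A` maps the tangent
cone of `K` at `X` onto the whole space. -/
def SlaterCondition : Prop :=
  ∃ X : SymMat n, P.A X = P.b ∧ X ∈ pdCone n ∩ intrinsicInterior ℝ P.K ∧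
    P.A '' posTangentConeAt P.K X = Set.univ

/-- One iteration of the inexact semi-proximal ADMM with tolerance `ε`, leading from
`(Z, W, S, y, X)` to `(Z', W', S', y', X')`. -/
def PhaseIStep (σ τ ε : ℝ)
    (Z _W S : SymMat n) (y : EuclideanSpace ℝ (Fin m)) (X : SymMat n)
    (Z' W' S' : SymMat n) (y' : EuclideanSpace ℝ (Fin m)) (X' : SymMat n) : Prop :=
  ∃ (What : SymMat n) (yhat : EuclideanSpace ℝ (Fin m))
    (δQhat δQ : SymMat n) (δyhat δy : EuclideanSpace ℝ (Fin m)),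
    -- the error vectors
    δQhat ∈ P.rangeQ ∧ δQ ∈ P.rangeQ ∧
    max (max ‖δy‖ ‖δyhat‖) (max ‖δQ‖ ‖δQhat‖) ≤ ε ∧
    -- the six subproblems
    IsArgmin (fun V => P.augLagrangian σ Z V S y X - ((⟪δQhat, V⟫_ℝ : ℝ) : EReal))
      P.rangeQ What ∧
    IsArgmin (fun V => P.augLagrangian σ V What S y X) Set.univ Z' ∧
    IsArgmin (fun V => P.augLagrangian σ Z' V S y X - ((⟪δQ, V⟫_ℝ : ℝ) : EReal))
      P.rangeQ W' ∧
    IsArgmin (fun v => P.augLagrangian σ Z' W' S v X - ((⟪δyhat, v⟫_ℝ : ℝ) : EReal))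
      Set.univ yhat ∧
    IsArgmin (fun V => P.augLagrangian σ Z' W' V yhat X) Set.univ S' ∧
    IsArgmin (fun v => P.augLagrangian σ Z' W' S' v X - ((⟪δy, v⟫_ℝ : ℝ) : EReal))
      Set.univ y' ∧
    -- the multiplier update
    X' = X + (τ * σ) • P.residual Z' W' S' y'

/-- `(Z k, W k, S k, y k, X k)` is a sequence generated by the algorithm with parameters `σ`, `τ`
and tolerances `ε k`. -/
structure IsPhaseISequence (σ τ : ℝ) (ε : ℕ → ℝ) (Z W S : ℕ → SymMat n)
    (y : ℕ → EuclideanSpace ℝ (Fin m)) (X : ℕ → SymMat n) : Prop where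
  init_Z : -Z 0 ∈ effDom P.suppK
  init_W : W 0 ∈ P.rangeQ
  init_S : S 0 ∈ psdCone n
  step : ∀ k, P.PhaseIStep σ τ (ε k) (Z k) (W k) (S k) (y k) (X k)
    (Z (k + 1)) (W (k + 1)) (S (k + 1)) (y (k + 1)) (X (k + 1))

end QSDP

/-!
The algorithm is a two-block semi-proximal ADMM in disguise. Each iteration solves for `W` twice,
before and after `Z`, and for `y` twice, before and after `S`. Since `W` and `y` enter the augmented
Lagrangian quadratically, the first of the two solves can be eliminated: it amounts to adding the
proximal terms `½‖Z - Zᵏ‖²_T` with `T = σ² (1 + σ Q)⁻¹ Q`, respectively `½‖S - Sᵏ‖²_T` with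
`T = σ A* (A A*)⁻¹ A`, to the joint minimizations over `(Z, W)` and over `(S, y)`
(`QSDP.exists_step_of_phaseIStep`). The error vectors become perturbations of the optimality
conditions of size `O(ε k)`.

For the two-block method (`SplitProblem`) the nonsmooth terms matter only through the closed
monotone relations given by their subdifferentials. Testing the optimality conditions of an
iteration against a Karush–Kuhn–Tucker point, and those of the second block against the previous
iteration, gives the decrease of a Lyapunov function (`SplitProblem.IsKKT.energy_descent`); the
coefficients are positive exactly because `1 + τ - τ² > 0`, that is, `τ` is below the golden ratio
(`exists_descent_constants`). The Lyapunov function dominates the squared distance to the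
KKT point in all variables (`SplitProblem.exists_norm_le_sqrt_energy`): this uses that `A` is
surjective and that `W` stays in the range of `Q`. Hence the perturbations cost at most a summable
multiple of its square root, the square root converges (`quasiFejer_tendsto`), the iterates are
bounded and the decrements vanish. A cluster point is therefore a KKT point, and the Lyapunov
function relative to this cluster point tends to `0` along a subsequence, hence along the whole
sequence (`SplitProblem.exists_isKKT_tendsto`).

A KKT point exists because of the Slater condition (`QSDP.exists_multipliers`): Hahn–Banach
separation, using the positive definite feasible point, splits off the multiplier of the
semidefinite constraint, and Farkas' lemma provides the multipliers of the affine and polyhedral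
constraints. Conversely KKT points are primal and dual optimal by weak duality.
-/

/-! ### Quadratic inequalities behind the step-length bound -/

theorem one_add_sub_sq_pos_of_lt_golden {τ : ℝ} (hτ : 0 < τ) (hτ' : τ < (1 + √5) / 2) :
    0 < 1 + τ - τ ^ 2 := by
  have h5 : √5 ^ 2 = 5 := Real.sq_sqrt (by norm_num)
  have h5' : 2 < √5 := by
    rw [Real.lt_sqrt (by norm_num)]; norm_num
  nlinarith

section Core

variable {E : Type*} [NormedAddCommGroup E] [InnerProductSpace ℝ E]

theorem two_inner_le_weighted (v w : E) {l : ℝ} (hl : 0 < l) :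
    2 * |⟪v, w⟫_ℝ| ≤ l * ‖v‖ ^ 2 + ‖w‖ ^ 2 / l := by
  have h1 := abs_real_inner_le_norm v w
  have h2 : 0 ≤ (l * ‖v‖ - ‖w‖) ^ 2 / l := by positivity
  have h3 : (l * ‖v‖ - ‖w‖) ^ 2 / l = l * ‖v‖ ^ 2 + ‖w‖ ^ 2 / l - 2 * (‖v‖ * ‖w‖) := by
    field_simp; ring
  linarith

/-- The quadratic form arising in one ADMM step dominates a telescoping term plus a positive
definite one. The cross term with the previous residual `w` is absorbed with weight `1` if `τ ≤ 1`
and with weight `τ` otherwise. -/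
theorem exists_descent_constants {τ : ℝ} (hτ : 0 < τ) (hτ' : τ < (1 + √5) / 2) :
    ∃ c κ : ℝ, 0 < c ∧ 0 < κ ∧ ∀ u v w : E,
      c * (‖u‖ ^ 2 - ‖w‖ ^ 2) + κ * (‖u‖ ^ 2 + ‖v‖ ^ 2) ≤
        (2 - τ) * ‖u‖ ^ 2 - 2 * (1 - τ) * ⟪v, w⟫_ℝ + ‖v‖ ^ 2 := by
  have hg := one_add_sub_sq_pos_of_lt_golden hτ hτ'
  rcases le_or_gt τ 1 with h1 | h1
  · refine ⟨1 - τ + τ / 2, τ / 2, by linarith, by linarith, fun u v w => ?_⟩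
    have hvw := two_inner_le_weighted v w one_pos
    have := mul_le_mul_of_nonneg_left ((mul_le_mul_of_nonneg_left
      (le_abs_self ⟪v, w⟫_ℝ) zero_le_two).trans hvw) (sub_nonneg.2 h1)
    have hv := mul_nonneg hτ.le (sq_nonneg ‖v‖)
    have hw := mul_nonneg hτ.le (sq_nonneg ‖w‖)
    nlinarith
  · -- `κ₀ = (1 + τ - τ²) / τ` is where the golden ratio enters
    obtain ⟨κ, hκ⟩ : ∃ κ, κ = (1 + τ - τ ^ 2) / τ := ⟨_, rfl⟩
    have hκ0 : 0 < κ := by rw [hκ]; positivity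
    have hκτ : κ * τ = 1 + τ - τ ^ 2 := by rw [hκ]; field_simp
    have hinv : 1 / τ < 1 := by rw [div_lt_one hτ]; exact h1
    refine ⟨1 - 1 / τ + κ / 2, κ / 2, by linarith, by linarith, fun u v w => ?_⟩
    have hvw := two_inner_le_weighted v w hτ
    have h2 := mul_le_mul_of_nonneg_left ((mul_le_mul_of_nonneg_left
      (neg_le_abs ⟪v, w⟫_ℝ) zero_le_two).trans hvw) (sub_nonneg.2 h1.le)
    have hv := mul_nonneg hκ0.le (sq_nonneg ‖v‖)
    have hw := mul_nonneg hκ0.le (sq_nonneg ‖w‖)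
    have e1 : κ = 1 / τ + 1 - τ := by rw [hκ]; field_simp
    have e2 : (τ - 1) * (‖w‖ ^ 2 / τ) = (1 - 1 / τ) * ‖w‖ ^ 2 := by field_simp
    have e3 : κ * τ * ‖v‖ ^ 2 ≥ κ * ‖v‖ ^ 2 := by nlinarith
    have e4 : (1 + τ - τ ^ 2) * ‖v‖ ^ 2 ≥ κ * ‖v‖ ^ 2 := by rw [← hκτ]; exact e3
    have e5 : (2 - τ) * ‖u‖ ^ 2 = (1 - 1 / τ) * ‖u‖ ^ 2 + κ * ‖u‖ ^ 2 := by rw [e1]; ring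
    nlinarith

/-- The algebra of one two-block ADMM step. The inequalities `h₁` and `h₂` are the monotonicity
of the two blocks tested against a saddle point, `h₃` the monotonicity of the second block
between consecutive iterates; the latter controls the cross term `⟪r', g' - g⟫`. -/
theorem admm_step_inequality {σ τ c κ : ℝ} (hσ : 0 < σ) (hτ : 0 < τ)
    (hcκ : ∀ u v w : E, c * (‖u‖ ^ 2 - ‖w‖ ^ 2) + κ * (‖u‖ ^ 2 + ‖v‖ ^ 2) ≤
        (2 - τ) * ‖u‖ ^ 2 - 2 * (1 - τ) * ⟪v, w⟫_ℝ + ‖v‖ ^ 2)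
    {x x' r r' f' g g' : E} {t₁ t₂ t₃ e₁ e₂ e₃ : ℝ}
    (hr : r' = f' + g') (hx : x' = x + (τ * σ) • r')
    (h₁ : ⟪f', x + σ • (f' + g)⟫_ℝ + t₁ ≤ e₁)
    (h₂ : ⟪g', x + σ • r'⟫_ℝ + t₂ ≤ e₂)
    (h₃ : ⟪g' - g, σ • (r' - (1 - τ) • r)⟫_ℝ + t₃ ≤ e₃) :
    (τ * σ)⁻¹ * ‖x'‖ ^ 2 + σ * ‖g'‖ ^ 2 + c * σ * ‖r'‖ ^ 2
      + κ * σ * (‖r'‖ ^ 2 + ‖g' - g‖ ^ 2) + 2 * t₁ + 2 * t₂ + 2 * t₃ ≤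
    (τ * σ)⁻¹ * ‖x‖ ^ 2 + σ * ‖g‖ ^ 2 + c * σ * ‖r‖ ^ 2 + 2 * e₁ + 2 * e₂ + 2 * e₃ := by
  have hq := mul_le_mul_of_nonneg_left (hcκ r' (g' - g) r) hσ.le
  have hx' : (τ * σ)⁻¹ * ‖x'‖ ^ 2 =
      (τ * σ)⁻¹ * ‖x‖ ^ 2 + 2 * ⟪r', x⟫_ℝ + τ * σ * ‖r'‖ ^ 2 := by
    rw [hx, norm_add_sq_real, norm_smul, inner_smul_right, real_inner_comm, Real.norm_eq_abs,
      abs_of_pos (mul_pos hτ hσ)]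
    field_simp
  obtain rfl : f' = r' - g' := by rw [hr]; abel
  rw [show r' - g' + g = r' - (g' - g) by abel] at h₁
  have a1 : ⟪r' - g', x + σ • (r' - (g' - g))⟫_ℝ + ⟪g', x + σ • r'⟫_ℝ =
      ⟪r', x⟫_ℝ + σ * ‖r'‖ ^ 2 - σ * ⟪r', g' - g⟫_ℝ + σ * ⟪g', g' - g⟫_ℝ := by
    simp only [inner_sub_left, inner_add_right, inner_smul_right, inner_sub_right,
      ← real_inner_self_eq_norm_sq]
    ring
  have a2 : 2 * ⟪g', g' - g⟫_ℝ = ‖g'‖ ^ 2 - ‖g‖ ^ 2 + ‖g' - g‖ ^ 2 := by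
    rw [norm_sub_sq_real, inner_sub_right, real_inner_self_eq_norm_sq]
    ring
  have a3 : ⟪g' - g, σ • (r' - (1 - τ) • r)⟫_ℝ =
      σ * ⟪r', g' - g⟫_ℝ - σ * (1 - τ) * ⟪g' - g, r⟫_ℝ := by
    rw [inner_smul_right, inner_sub_right, inner_smul_right, real_inner_comm]
    ring
  rw [hx']
  nlinarith

end Core

/-! ### Quasi-Fejér sequences of reals -/

/-- A nonnegative sequence whose squares decrease by `s k` up to an error that is a summable
multiple of the sequence itself converges, and the decrements `s k` tend to `0`. -/
theorem quasiFejer_tendsto {a c s : ℕ → ℝ} (ha : ∀ k, 0 ≤ a k) (hc : ∀ k, 0 ≤ c k)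
    (hs : ∀ k, 0 ≤ s k) (hcs : Summable c)
    (h : ∀ k, a (k + 1) ^ 2 + s k ≤ a k ^ 2 + c k * (a k + a (k + 1))) :
    (∃ l, Tendsto a atTop (𝓝 l)) ∧ Tendsto s atTop (𝓝 0) := by
  have h1 : ∀ k, a (k + 1) ≤ a k + c k := by
    intro k
    by_contra! hlt
    have := h k
    have h2 := hs k
    have h3 := hc k
    have h4 := ha k
    have h5 := ha (k + 1)
    nlinarith
  have hanti : Antitone (fun k => a k - ∑ i ∈ Finset.range k, c i) := by
    refine antitone_nat_of_succ_le fun k => ?_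
    rw [Finset.sum_range_succ]
    linarith [h1 k]
  have hbdd : BddBelow (Set.range (fun k => a k - ∑ i ∈ Finset.range k, c i)) := by
    refine ⟨-∑' i, c i, ?_⟩
    rintro _ ⟨k, rfl⟩
    have := hcs.sum_le_tsum (Finset.range k) (fun i _ => hc i)
    have := ha k
    simp only
    linarith
  have ht := (tendsto_atTop_ciInf hanti hbdd).add hcs.hasSum.tendsto_sum_nat
  simp only [sub_add_cancel] at ht
  refine ⟨⟨_, ht⟩, ?_⟩
  have ht' := ht.comp (tendsto_add_atTop_nat 1)
  have hlim := ((ht.pow 2).sub (ht'.pow 2)).add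
    (hcs.tendsto_atTop_zero.mul (ht.add ht'))
  rw [sub_self, zero_mul, add_zero] at hlim
  refine squeeze_zero hs (fun k => ?_) hlim
  have := h k
  simp only [Function.comp]
  linarith

/-! ### Convergence of the reduced two-block iteration -/

/-- The data of a two-block semi-proximal ADMM for the constraint `Z - Q W + S + A* y = C`.
The nonsmooth terms enter only through the closed relations `M₁` and `M₂`, where `(Z, X) ∈ M₁`
says that `-X` is a subgradient at `Z` of the first term, and likewise for `M₂`; monotonicity of
the subdifferential becomes `M₁_anti`. The operators `T₁` and `T₂` are the proximal terms on `Z`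
and on `S`. -/
structure SplitProblem (E V : Type*) [NormedAddCommGroup E] [InnerProductSpace ℝ E]
    [FiniteDimensional ℝ E] [NormedAddCommGroup V] [InnerProductSpace ℝ V]
    [FiniteDimensional ℝ V] where
  Q : E →ₗ[ℝ] E
  A : E →ₗ[ℝ] V
  T₁ : E →ₗ[ℝ] E
  T₂ : E →ₗ[ℝ] E
  M₁ : Set (E × E)
  M₂ : Set (E × E)
  C : E
  b : V
  σ : ℝ
  τ : ℝ
  Q_pos : Q.IsPositive
  A_surj : Function.Surjective A
  T₁_pos : T₁.IsPositive
  T₂_pos : T₂.IsPositive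
  T₁_sq : ∀ x, ‖T₁ x‖ ^ 2 ≤ σ * ⟪x, T₁ x⟫_ℝ
  T₂_sq : ∀ x, ‖T₂ x‖ ^ 2 ≤ σ * ⟪x, T₂ x⟫_ℝ
  T₁_ker : ∀ x, T₁ x = 0 → Q x = 0
  T₂_ker : ∀ x, T₂ x = 0 → A x = 0
  M₁_closed : IsClosed M₁
  M₂_closed : IsClosed M₂
  M₁_anti : ∀ p ∈ M₁, ∀ q ∈ M₁, ⟪p.1 - q.1, p.2 - q.2⟫_ℝ ≤ 0
  M₂_anti : ∀ p ∈ M₂, ∀ q ∈ M₂, ⟪p.1 - q.1, p.2 - q.2⟫_ℝ ≤ 0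
  σ_pos : 0 < σ
  τ_pos : 0 < τ
  τ_lt : τ < (1 + √5) / 2

theorem LinearMap.IsPositive.inner_sub_eq {E : Type*} [NormedAddCommGroup E]
    [InnerProductSpace ℝ E] {T : E →ₗ[ℝ] E} (hT : T.IsPositive) (u v : E) :
    2 * ⟪u, T (u - v)⟫_ℝ = ⟪u, T u⟫_ℝ - ⟪v, T v⟫_ℝ + ⟪u - v, T (u - v)⟫_ℝ := by
  have h : ⟪v, T u⟫_ℝ = ⟪u, T v⟫_ℝ := by rw [← hT.isSymmetric v u, real_inner_comm]
  simp only [map_sub, inner_sub_left, inner_sub_right]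
  linarith

namespace SplitProblem

variable {E V : Type*} [NormedAddCommGroup E] [InnerProductSpace ℝ E]
    [FiniteDimensional ℝ E] [NormedAddCommGroup V] [InnerProductSpace ℝ V]
    [FiniteDimensional ℝ V] (D : SplitProblem E V)

/-- The residual of the linear constraint. -/
noncomputable def res (Z W S : E) (y : V) : E := Z - D.Q W + S + LinearMap.adjoint D.A y - D.C

/-- The Karush–Kuhn–Tucker conditions. -/
structure IsKKT (Z W S : E) (y : V) (X : E) : Prop where
  mem₁ : (Z, X) ∈ D.M₁
  mem₂ : (S, X) ∈ D.M₂
  range : W ∈ LinearMap.range D.Q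
  Q_eq : D.Q W = D.Q X
  A_eq : D.A X = D.b
  res_eq : D.res Z W S y = 0

/-- One step of the inexact semi-proximal ADMM, expressed by the optimality conditions of its two
block subproblems, with perturbations of size at most `η`. -/
def Step (η : ℝ) (Z S : E) (y : V) (X : E) (Z' W' S' : E) (y' : V) (X' : E) : Prop :=
  ∃ (e₁ d₁ e₂ : E) (d₂ : V), ‖e₁‖ ≤ η ∧ ‖d₁‖ ≤ η ∧ ‖e₂‖ ≤ η ∧ ‖d₂‖ ≤ η ∧
    (Z', X + D.σ • D.res Z' W' S y + D.T₁ (Z' - Z) + e₁) ∈ D.M₁ ∧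
    W' ∈ LinearMap.range D.Q ∧
    D.Q W' = D.Q (X + D.σ • D.res Z' W' S y) + d₁ ∧
    (S', X + D.σ • D.res Z' W' S' y' + D.T₂ (S' - S) + e₂) ∈ D.M₂ ∧
    D.A (X + D.σ • D.res Z' W' S' y') = D.b + d₂ ∧
    X' = X + (D.τ * D.σ) • D.res Z' W' S' y'

/-- The Lyapunov function of the iteration, as a function of the distances `z`, `s`, `y`, `x` to a
saddle point, the residual `r` and the last increment `d` of the `S`-block. -/
noncomputable def energy (c : ℝ) (z s : E) (y : V) (x r d : E) : ℝ :=
  (D.τ * D.σ)⁻¹ * ‖x‖ ^ 2 + D.σ * ‖s + LinearMap.adjoint D.A y‖ ^ 2 + c * D.σ * ‖r‖ ^ 2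
    + ⟪z, D.T₁ z⟫_ℝ + ⟪s, D.T₂ s⟫_ℝ + ⟪d, D.T₂ d⟫_ℝ

/-- The guaranteed decrease of the Lyapunov function in an exact step. -/
noncomputable def decrement (κ : ℝ) (r dz d : E) (dy : V) : ℝ :=
  κ * D.σ * (‖r‖ ^ 2 + ‖d + LinearMap.adjoint D.A dy‖ ^ 2) + ⟪dz, D.T₁ dz⟫_ℝ + ⟪d, D.T₂ d⟫_ℝ

theorem energy_nonneg {c : ℝ} (hc : 0 ≤ c) (z s : E) (y : V) (x r d : E) :
    0 ≤ D.energy c z s y x r d := by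
  have := D.σ_pos
  have := D.τ_pos
  have := D.T₁_pos.inner_nonneg_right z
  have := D.T₂_pos.inner_nonneg_right s
  have := D.T₂_pos.inner_nonneg_right d
  unfold energy
  positivity

theorem decrement_nonneg {κ : ℝ} (hκ : 0 ≤ κ) (r dz d : E) (dy : V) :
    0 ≤ D.decrement κ r dz d dy := by
  have := D.σ_pos
  have := D.T₁_pos.inner_nonneg_right dz
  have := D.T₂_pos.inner_nonneg_right d
  unfold decrement
  positivity

theorem adjoint_injective : Function.Injective (LinearMap.adjoint D.A) := by
  rw [← LinearMap.ker_eq_bot, LinearMap.ker_eq_bot']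
  intro y hy
  obtain ⟨x, rfl⟩ := D.A_surj y
  rw [← inner_self_eq_zero (𝕜 := ℝ), ← LinearMap.adjoint_inner_right, hy, inner_zero_right]

theorem Q_eq_zero_of_Q_Q {x : E} (h : D.Q (D.Q x) = 0) : D.Q x = 0 := by
  rw [← inner_self_eq_zero (𝕜 := ℝ), D.Q_pos.isSymmetric, h, inner_zero_right]

variable {D}

theorem IsKKT.res_eq_sub {Z W S : E} {y : V} {X : E} (h : D.IsKKT Z W S y X)
    (Z' W' S' : E) (y' : V) :
    D.res Z' W' S' y' = (Z' - Z - D.Q (W' - W)) + (S' - S + LinearMap.adjoint D.A (y' - y)) := by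
  have := h.res_eq
  have h2 : D.res Z' W' S' y' = D.res Z' W' S' y' - D.res Z W S y := by rw [this, sub_zero]
  rw [h2]
  simp only [res, map_sub]
  abel

theorem inner_le_of_norm_le {F : Type*} [NormedAddCommGroup F] [InnerProductSpace ℝ F]
    (u : F) {v : F} {η : ℝ} (hv : ‖v‖ ≤ η) : |⟪u, v⟫_ℝ| ≤ η * ‖u‖ :=
  (abs_real_inner_le_norm u v).trans (by
    rw [mul_comm]; exact mul_le_mul_of_nonneg_right hv (norm_nonneg _))

/-- Two consecutive steps decrease the Lyapunov function relative to any KKT point, up to an error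
that is linear in the distances to this point. -/
theorem IsKKT.energy_descent {c κ : ℝ}
    (hcκ : ∀ u v w : E, c * (‖u‖ ^ 2 - ‖w‖ ^ 2) + κ * (‖u‖ ^ 2 + ‖v‖ ^ 2) ≤
        (2 - D.τ) * ‖u‖ ^ 2 - 2 * (1 - D.τ) * ⟪v, w⟫_ℝ + ‖v‖ ^ 2)
    {Z W S : E} {y : V} {X : E} (hK : D.IsKKT Z W S y X)
    {η₁ η₂ : ℝ} {Z₀ S₀ X₀ Z₁ W₁ S₁ X₁ Z₂ W₂ S₂ X₂ : E} {y₀ y₁ y₂ : V}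
    (h₁ : D.Step η₁ Z₀ S₀ y₀ X₀ Z₁ W₁ S₁ y₁ X₁)
    (h₂ : D.Step η₂ Z₁ S₁ y₁ X₁ Z₂ W₂ S₂ y₂ X₂) :
    D.energy c (Z₂ - Z) (S₂ - S) (y₂ - y) (X₂ - X) (D.res Z₂ W₂ S₂ y₂) (S₂ - S₁)
      + D.decrement κ (D.res Z₂ W₂ S₂ y₂) (Z₂ - Z₁) (S₂ - S₁) (y₂ - y₁) ≤
    D.energy c (Z₁ - Z) (S₁ - S) (y₁ - y) (X₁ - X) (D.res Z₁ W₁ S₁ y₁) (S₁ - S₀)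
      + 4 * (η₁ + η₂) * ((‖Z₁ - Z‖ + ‖W₁ - W‖ + ‖S₁ - S‖ + ‖y₁ - y‖)
        + (‖Z₂ - Z‖ + ‖W₂ - W‖ + ‖S₂ - S‖ + ‖y₂ - y‖)) := by
  obtain ⟨a₁, b₁, a₂, b₂, ha₁, hb₁, ha₂, hb₂, -, -, -, hS₁, hA₁, hX₁⟩ := h₁
  obtain ⟨e₁, d₁, e₂, d₂, he₁, hd₁, he₂, hd₂, hZ, -, hW, hS₂, hA₂, hX₂⟩ := h₂
  have hη₁ : 0 ≤ η₁ := (norm_nonneg _).trans ha₁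
  have hη₂ : 0 ≤ η₂ := (norm_nonneg _).trans he₁
  have hr₂ := hK.res_eq_sub Z₂ W₂ S₂ y₂
  have hrm := hK.res_eq_sub Z₂ W₂ S₁ y₁
  -- monotonicity of the two blocks against the saddle point
  have m₁ := D.M₁_anti _ hZ _ hK.mem₁
  have m₂ := D.M₂_anti _ hS₂ _ hK.mem₂
  -- monotonicity of the second block between consecutive iterates
  have m₃ := D.M₂_anti _ hS₂ _ hS₁
  simp only at m₁ m₂ m₃
  set x := X₁ - X with hx
  set f := Z₂ - Z - D.Q (W₂ - W) with hf
  set g := S₁ - S + LinearMap.adjoint D.A (y₁ - y) with hg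
  set g' := S₂ - S + LinearMap.adjoint D.A (y₂ - y) with hg'
  set r := D.res Z₁ W₁ S₁ y₁ with hr
  set r' := D.res Z₂ W₂ S₂ y₂ with hr'
  have q₁ : ⟪f, x + D.σ • (f + g)⟫_ℝ + ⟪Z₂ - Z, D.T₁ (Z₂ - Z₁)⟫_ℝ ≤
      η₂ * ‖Z₂ - Z‖ + η₂ * ‖W₂ - W‖ := by
    rw [hrm] at m₁ hW
    have w0 : D.Q (W₂ - W) = D.Q (x + D.σ • (f + g)) + d₁ := by
      rw [map_sub D.Q W₂ W, hW, hK.Q_eq, hx, sub_add_eq_add_sub X₁ X,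
        map_sub D.Q (X₁ + D.σ • (f + g)) X, add_sub_right_comm]
    have w1 : 0 ≤ ⟪W₂ - W, D.Q (W₂ - W)⟫_ℝ := D.Q_pos.inner_nonneg_right _
    rw [w0, inner_add_right, ← D.Q_pos.isSymmetric] at w1
    have w2 := (abs_le.1 (inner_le_of_norm_le (W₂ - W) hd₁)).2
    have w3 := (abs_le.1 (inner_le_of_norm_le (Z₂ - Z) he₁)).1
    have m : X₁ + D.σ • (f + g) + D.T₁ (Z₂ - Z₁) + e₁ - X =
      (x + D.σ • (f + g)) + D.T₁ (Z₂ - Z₁) + e₁ := by rw [hx]; abel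
    rw [m, inner_add_right, inner_add_right] at m₁
    have : ⟪f, x + D.σ • (f + g)⟫_ℝ = ⟪Z₂ - Z, x + D.σ • (f + g)⟫_ℝ
      - ⟪D.Q (W₂ - W), x + D.σ • (f + g)⟫_ℝ := by rw [← inner_sub_left]
    linarith
  have q₂ : ⟪g', x + D.σ • r'⟫_ℝ + ⟪S₂ - S, D.T₂ (S₂ - S₁)⟫_ℝ ≤
      η₂ * ‖S₂ - S‖ + η₂ * ‖y₂ - y‖ := by
    have w0 : D.A (x + D.σ • r') = d₂ := by
      rw [hx, sub_add_eq_add_sub, map_sub, hA₂, hK.A_eq]; abel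
    have w2 := (abs_le.1 (inner_le_of_norm_le (y₂ - y) hd₂)).2
    have w3 := (abs_le.1 (inner_le_of_norm_le (S₂ - S) he₂)).1
    have m : X₁ + D.σ • r' + D.T₂ (S₂ - S₁) + e₂ - X =
      (x + D.σ • r') + D.T₂ (S₂ - S₁) + e₂ := by rw [hx]; abel
    rw [m, inner_add_right, inner_add_right] at m₂
    rw [hg', inner_add_left, LinearMap.adjoint_inner_left, w0]
    linarith
  have hxr : X₁ + D.σ • r' - (X₀ + D.σ • r) = D.σ • (r' - (1 - D.τ) • r) := by
    rw [hX₁]; module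
  have q₃ : ⟪g' - g, D.σ • (r' - (1 - D.τ) • r)⟫_ℝ
      + ⟪S₂ - S₁, D.T₂ ((S₂ - S₁) - (S₁ - S₀))⟫_ℝ ≤
      (η₁ + η₂) * ‖S₂ - S₁‖ + (η₁ + η₂) * ‖y₂ - y₁‖ := by
    have w0 : D.A (D.σ • (r' - (1 - D.τ) • r)) = d₂ - b₂ := by
      rw [← hxr, map_sub, hA₂, hA₁]; abel
    have n1 : ‖e₂ - a₂‖ ≤ η₁ + η₂ := (norm_sub_le _ _).trans (by linarith)
    have n2 : ‖d₂ - b₂‖ ≤ η₁ + η₂ := (norm_sub_le _ _).trans (by linarith)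
    have w2 := (abs_le.1 (inner_le_of_norm_le (y₂ - y₁) n2)).2
    have w3 := (abs_le.1 (inner_le_of_norm_le (S₂ - S₁) n1)).1
    have m : X₁ + D.σ • r' + D.T₂ (S₂ - S₁) + e₂ - (X₀ + D.σ • r + D.T₂ (S₁ - S₀) + a₂) =
      D.σ • (r' - (1 - D.τ) • r) + D.T₂ ((S₂ - S₁) - (S₁ - S₀)) + (e₂ - a₂) := by
      rw [← hxr, map_sub D.T₂ (S₂ - S₁)]; abel
    rw [m, inner_add_right, inner_add_right] at m₃
    have hgg : g' - g = (S₂ - S₁) + LinearMap.adjoint D.A (y₂ - y₁) := by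
      rw [hg, hg']; simp only [map_sub]; abel
    rw [hgg, inner_add_left, LinearMap.adjoint_inner_left, w0]
    linarith
  have hx₂ : X₂ - X = x + (D.τ * D.σ) • r' := by rw [hX₂, hx]; abel
  have key := admm_step_inequality D.σ_pos D.τ_pos hcκ hr₂ hx₂ q₁ q₂ q₃
  have p₁ := D.T₁_pos.inner_sub_eq (Z₂ - Z) (Z₁ - Z)
  have p₂ := D.T₂_pos.inner_sub_eq (S₂ - S) (S₁ - S)
  have p₃ := D.T₂_pos.inner_sub_eq (S₂ - S₁) (S₁ - S₀)
  have p₄ := D.T₂_pos.inner_nonneg_right ((S₂ - S₁) - (S₁ - S₀))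
  rw [sub_sub_sub_cancel_right] at p₁ p₂
  have hgg : g' - g = (S₂ - S₁) + LinearMap.adjoint D.A (y₂ - y₁) := by
    rw [hg, hg']; simp only [map_sub]; abel
  have t₁ : ‖S₂ - S₁‖ ≤ ‖S₂ - S‖ + ‖S₁ - S‖ := by
    rw [← sub_sub_sub_cancel_right S₂ S₁ S]; exact norm_sub_le _ _
  have t₂ : ‖y₂ - y₁‖ ≤ ‖y₂ - y‖ + ‖y₁ - y‖ := by
    rw [← sub_sub_sub_cancel_right y₂ y₁ y]; exact norm_sub_le _ _
  have t₃ := mul_le_mul_of_nonneg_left t₁ (add_nonneg hη₁ hη₂)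
  have t₄ := mul_le_mul_of_nonneg_left t₂ (add_nonneg hη₁ hη₂)
  have n := fun t : ℝ => fun ht : 0 ≤ t => mul_nonneg hη₁ ht
  have n' := fun t : ℝ => fun ht : 0 ≤ t => mul_nonneg hη₂ ht
  have n1 := n _ (norm_nonneg (Z₂ - Z))
  have n2 := n _ (norm_nonneg (W₂ - W))
  have n3 := n _ (norm_nonneg (S₂ - S))
  have n4 := n _ (norm_nonneg (y₂ - y))
  have n5 := n _ (norm_nonneg (Z₁ - Z))
  have n6 := n _ (norm_nonneg (W₁ - W))
  have n7 := n _ (norm_nonneg (S₁ - S))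
  have n8 := n _ (norm_nonneg (y₁ - y))
  have k1 := n' _ (norm_nonneg (Z₂ - Z))
  have k2 := n' _ (norm_nonneg (W₂ - W))
  have k3 := n' _ (norm_nonneg (S₂ - S))
  have k4 := n' _ (norm_nonneg (y₂ - y))
  have k5 := n' _ (norm_nonneg (Z₁ - Z))
  have k6 := n' _ (norm_nonneg (W₁ - W))
  have k7 := n' _ (norm_nonneg (S₁ - S))
  have k8 := n' _ (norm_nonneg (y₁ - y))
  unfold energy decrement
  rw [← hgg, ← hg, ← hg']
  linarith

variable (D)

/-- The proximal terms and the constraint operators jointly determine `(Z, W, S, y)`. This is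
where surjectivity of `A` and the restriction of `W` to the range of `Q` are used. -/
theorem exists_norm_le :
    ∃ L : ℝ, 0 ≤ L ∧ ∀ (z w s : E) (y : V), w ∈ LinearMap.range D.Q →
      ‖z‖ + ‖w‖ + ‖s‖ + ‖y‖ ≤ L * (‖D.T₁ z‖ + ‖z - D.Q w‖ + ‖D.T₂ s‖
        + ‖s + LinearMap.adjoint D.A y‖) := by
  let R := LinearMap.range D.Q
  let p₁ : (E × R × E × V) →ₗ[ℝ] E := LinearMap.fst ℝ _ _
  let p₂ : (E × R × E × V) →ₗ[ℝ] E :=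
    R.subtype ∘ₗ LinearMap.fst ℝ _ _ ∘ₗ LinearMap.snd ℝ _ _
  let p₃ : (E × R × E × V) →ₗ[ℝ] E :=
    LinearMap.fst ℝ _ _ ∘ₗ LinearMap.snd ℝ _ _ ∘ₗ LinearMap.snd ℝ _ _
  let p₄ : (E × R × E × V) →ₗ[ℝ] V :=
    LinearMap.snd ℝ _ _ ∘ₗ LinearMap.snd ℝ _ _ ∘ₗ LinearMap.snd ℝ _ _
  let f : (E × R × E × V) →ₗ[ℝ] (E × E × E × E) :=
    (D.T₁ ∘ₗ p₁).prod ((p₁ - D.Q ∘ₗ p₂).prod ((D.T₂ ∘ₗ p₃).prod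
      (p₃ + LinearMap.adjoint D.A ∘ₗ p₄)))
  have hf : LinearMap.ker f = ⊥ := by
    rw [LinearMap.ker_eq_bot']
    rintro ⟨z, ⟨w, u, rfl⟩, s, y⟩ h
    obtain ⟨h₁, h₂, h₃, h₄⟩ : D.T₁ z = 0 ∧ z - D.Q (D.Q u) = 0 ∧ D.T₂ s = 0 ∧
        s + LinearMap.adjoint D.A y = 0 := by
      simpa [f, p₁, p₂, p₃, p₄] using h
    have hz := sub_eq_zero.1 h₂
    have h5 := D.T₁_ker z h₁
    rw [hz] at h5
    have h6 := D.Q_eq_zero_of_Q_Q h5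
    have h7 : D.Q u = 0 := D.Q_eq_zero_of_Q_Q h6
    have hz0 : z = 0 := by rw [hz, h7, map_zero]
    have h8 := D.T₂_ker s h₃
    have h9 : LinearMap.adjoint D.A y = 0 := by
      rw [← inner_self_eq_zero (𝕜 := ℝ), LinearMap.adjoint_inner_left,
        ← neg_eq_of_add_eq_zero_right h₄, map_neg, h8, neg_zero, inner_zero_right]
    have hy : y = 0 := D.adjoint_injective (by rw [h9, map_zero])
    have hs : s = 0 := by simpa [h9] using h₄
    ext <;> simp [hz0, h7, hs, hy]
  obtain ⟨K, -, hK⟩ := f.exists_antilipschitzWith hf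
  refine ⟨4 * K, by positivity, fun z w s y hw => ?_⟩
  have h := hK.le_mul_dist (⟨z, ⟨w, hw⟩, s, y⟩ : E × R × E × V) 0
  rw [map_zero, dist_zero_right, dist_zero_right] at h
  have hfv : f ⟨z, ⟨w, hw⟩, s, y⟩ =
      (D.T₁ z, z - D.Q w, D.T₂ s, s + LinearMap.adjoint D.A y) := rfl
  rw [hfv] at h
  have n1 : ‖z‖ ≤ ‖(⟨z, ⟨w, hw⟩, s, y⟩ : E × R × E × V)‖ :=
    norm_fst_le (⟨z, ⟨w, hw⟩, s, y⟩ : E × R × E × V)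
  have n2' : ‖((⟨w, hw⟩, s, y) : R × E × V)‖ ≤ ‖(⟨z, ⟨w, hw⟩, s, y⟩ : E × R × E × V)‖ :=
    norm_snd_le (⟨z, ⟨w, hw⟩, s, y⟩ : E × R × E × V)
  have n2 : ‖w‖ ≤ ‖((⟨w, hw⟩, s, y) : R × E × V)‖ :=
    norm_fst_le ((⟨w, hw⟩, s, y) : R × E × V)
  have n3' : ‖(s, y)‖ ≤ ‖((⟨w, hw⟩, s, y) : R × E × V)‖ :=
    norm_snd_le ((⟨w, hw⟩, s, y) : R × E × V)
  have n3 : ‖s‖ ≤ ‖(s, y)‖ := norm_fst_le (s, y)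
  have n4 : ‖y‖ ≤ ‖(s, y)‖ := norm_snd_le (s, y)
  have hb : ‖(D.T₁ z, z - D.Q w, D.T₂ s, s + LinearMap.adjoint D.A y)‖ ≤
      ‖D.T₁ z‖ + ‖z - D.Q w‖ + ‖D.T₂ s‖ + ‖s + LinearMap.adjoint D.A y‖ := by
    simp only [Prod.norm_mk]
    have i1 := norm_nonneg (D.T₁ z)
    have i2 := norm_nonneg (z - D.Q w)
    have i3 := norm_nonneg (D.T₂ s)
    have i4 := norm_nonneg (s + LinearMap.adjoint D.A y)
    refine max_le (by linarith) (max_le (by linarith) (max_le (by linarith) (by linarith)))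
  have := mul_le_mul_of_nonneg_left hb K.coe_nonneg
  linarith

/-- The square root of the Lyapunov function bounds the distance to the saddle point. -/
theorem exists_norm_le_sqrt_energy {c : ℝ} (hc : 0 < c) :
    ∃ L : ℝ, 0 ≤ L ∧ ∀ (z w s : E) (y : V) (x r d : E), w ∈ LinearMap.range D.Q →
      r = (z - D.Q w) + (s + LinearMap.adjoint D.A y) →
      ‖z‖ + ‖w‖ + ‖s‖ + ‖y‖ + ‖x‖ ≤ L * √(D.energy c z s y x r d) := by
  obtain ⟨L, hL, h⟩ := D.exists_norm_le
  have hσ := D.σ_pos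
  have hτ := D.τ_pos
  refine ⟨L * (√D.σ + (√(c * D.σ)⁻¹ + √(D.σ⁻¹)) + √D.σ + √(D.σ⁻¹)) + √(D.τ * D.σ),
    by positivity, fun z w s y x r d hw hr => ?_⟩
  set φ := D.energy c z s y x r d with hφ
  have hφ0 : 0 ≤ φ := D.energy_nonneg hc.le z s y x r d
  have i1 : 0 ≤ ⟪z, D.T₁ z⟫_ℝ := D.T₁_pos.inner_nonneg_right z
  have i2 : 0 ≤ ⟪s, D.T₂ s⟫_ℝ := D.T₂_pos.inner_nonneg_right s
  have i3 : 0 ≤ ⟪d, D.T₂ d⟫_ℝ := D.T₂_pos.inner_nonneg_right d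
  have i4 : 0 ≤ (D.τ * D.σ)⁻¹ * ‖x‖ ^ 2 := by positivity
  have i5 : 0 ≤ D.σ * ‖s + LinearMap.adjoint D.A y‖ ^ 2 := by positivity
  have i6 : 0 ≤ c * D.σ * ‖r‖ ^ 2 := by positivity
  have aux : ∀ {u α : ℝ}, 0 < α → 0 ≤ u → α⁻¹ * u ^ 2 ≤ φ → u ≤ √α * √φ := by
    intro u α hα hu hle
    rw [← Real.sqrt_mul hα.le]
    refine Real.le_sqrt_of_sq_le ?_
    rwa [inv_mul_le_iff₀ hα] at hle
  have b1 : ‖D.T₁ z‖ ≤ √D.σ * √φ := by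
    refine aux hσ (norm_nonneg _) ?_
    rw [inv_mul_le_iff₀ hσ]
    refine (D.T₁_sq z).trans (mul_le_mul_of_nonneg_left ?_ hσ.le)
    rw [hφ, energy]; linarith
  have b2 : ‖D.T₂ s‖ ≤ √D.σ * √φ := by
    refine aux hσ (norm_nonneg _) ?_
    rw [inv_mul_le_iff₀ hσ]
    refine (D.T₂_sq s).trans (mul_le_mul_of_nonneg_left ?_ hσ.le)
    rw [hφ, energy]; linarith
  have b3 : ‖s + LinearMap.adjoint D.A y‖ ≤ √(D.σ⁻¹) * √φ := by
    refine aux (inv_pos.2 hσ) (norm_nonneg _) ?_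
    rw [inv_inv, hφ, energy]; linarith
  have b4 : ‖r‖ ≤ √(c * D.σ)⁻¹ * √φ := by
    refine aux (by positivity) (norm_nonneg _) ?_
    rw [inv_inv, hφ, energy]; linarith
  have b5 : ‖x‖ ≤ √(D.τ * D.σ) * √φ := by
    refine aux (by positivity) (norm_nonneg _) ?_
    rw [hφ, energy]; linarith
  have b6 : ‖z - D.Q w‖ ≤ ‖r‖ + ‖s + LinearMap.adjoint D.A y‖ := by
    rw [show z - D.Q w = r - (s + LinearMap.adjoint D.A y) by rw [hr]; abel]
    exact norm_sub_le _ _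
  have hb : ‖D.T₁ z‖ + ‖z - D.Q w‖ + ‖D.T₂ s‖ + ‖s + LinearMap.adjoint D.A y‖ ≤
      (√D.σ + (√(c * D.σ)⁻¹ + √(D.σ⁻¹)) + √D.σ + √(D.σ⁻¹)) * √φ := by
    linarith
  have := mul_le_mul_of_nonneg_left hb hL
  have := h z w s y hw
  linarith

end SplitProblem

/-! ### Cluster points and convergence -/

namespace SplitProblem

variable {E V : Type*} [NormedAddCommGroup E] [InnerProductSpace ℝ E]
    [FiniteDimensional ℝ E] [NormedAddCommGroup V] [InnerProductSpace ℝ V]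
    [FiniteDimensional ℝ V] {D : SplitProblem E V}

theorem tendsto_of_norm_succ_sub_le {F : Type*} [NormedAddCommGroup F] {v : ℕ → F} {vs : F}
    {a : ℕ → ℝ} (h : ∀ k, ‖v (k + 1) - vs‖ ≤ a k) (ha : Tendsto a atTop (𝓝 0)) :
    Tendsto v atTop (𝓝 vs) := by
  rw [← tendsto_add_atTop_iff_nat 1]
  exact tendsto_sub_nhds_zero_iff.1 (squeeze_zero_norm h ha)

/-- A vanishing decrement forces all the quantities entering the optimality conditions of a step
besides the iterates themselves to vanish. -/
theorem tendsto_of_decrement {κ : ℝ} (hκ : 0 < κ) {ι : Type*} {l : Filter ι}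
    {r dz d : ι → E} {dy : ι → V}
    (h : Tendsto (fun i => D.decrement κ (r i) (dz i) (d i) (dy i)) l (𝓝 0)) :
    Tendsto r l (𝓝 0) ∧ Tendsto (fun i => d i + LinearMap.adjoint D.A (dy i)) l (𝓝 0) ∧
      Tendsto (fun i => D.T₁ (dz i)) l (𝓝 0) ∧ Tendsto (fun i => D.T₂ (d i)) l (𝓝 0) ∧
      Tendsto (fun i => ⟪d i, D.T₂ (d i)⟫_ℝ) l (𝓝 0) := by
  have hσ := D.σ_pos
  have hκσ : 0 < κ * D.σ := mul_pos hκ hσ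
  have i1 := fun i => D.T₁_pos.inner_nonneg_right (dz i)
  have i2 := fun i => D.T₂_pos.inner_nonneg_right (d i)
  have i3 : ∀ i, 0 ≤ κ * D.σ * ‖r i‖ ^ 2 := fun i => by positivity
  have i4 : ∀ i, 0 ≤ κ * D.σ * ‖d i + LinearMap.adjoint D.A (dy i)‖ ^ 2 := fun i => by positivity
  have aux : ∀ {u : ι → E} (α : ℝ),
      (∀ i, ‖u i‖ ^ 2 ≤ α * D.decrement κ (r i) (dz i) (d i) (dy i)) →
      Tendsto u l (𝓝 0) := by
    intro u α hu
    have h0 := h.const_mul α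
    rw [mul_zero] at h0
    have h1 := squeeze_zero (fun i => sq_nonneg ‖u i‖) hu h0
    rw [tendsto_zero_iff_norm_tendsto_zero]
    simpa using h1.sqrt
  refine ⟨aux (κ * D.σ)⁻¹ fun i => ?_, aux (κ * D.σ)⁻¹ fun i => ?_, aux D.σ fun i => ?_,
    aux D.σ fun i => ?_, squeeze_zero i2 (fun i => ?_) h⟩
  · rw [le_inv_mul_iff₀ hκσ, decrement]
    linarith [i1 i, i2 i, i3 i, i4 i]
  · rw [le_inv_mul_iff₀ hκσ, decrement]
    linarith [i1 i, i2 i, i3 i, i4 i]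
  · refine (D.T₁_sq _).trans (mul_le_mul_of_nonneg_left ?_ hσ.le)
    rw [decrement]
    linarith [i1 i, i2 i, i3 i, i4 i]
  · refine (D.T₂_sq _).trans (mul_le_mul_of_nonneg_left ?_ hσ.le)
    rw [decrement]
    linarith [i1 i, i2 i, i3 i, i4 i]
  · rw [decrement]
    linarith [i1 i, i2 i, i3 i, i4 i]

theorem continuous_res : Continuous fun p : E × E × E × V => D.res p.1 p.2.1 p.2.2.1 p.2.2.2 := by
  have h1 : Continuous D.Q := D.Q.continuous_of_finiteDimensional
  have h2 : Continuous (LinearMap.adjoint D.A) :=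
    (LinearMap.adjoint D.A).continuous_of_finiteDimensional
  unfold res
  fun_prop

/-- Convergence of the perturbed two-block method: if a KKT point exists and the perturbations are
summable, then the iterates converge to a KKT point. -/
theorem exists_isKKT_tendsto {η : ℕ → ℝ} (hη : Summable η) {Z W S : ℕ → E} {y : ℕ → V}
    {X : ℕ → E}
    (hstep : ∀ k, D.Step (η k) (Z k) (S k) (y k) (X k) (Z (k + 1)) (W (k + 1)) (S (k + 1))
      (y (k + 1)) (X (k + 1)))
    (hK : ∃ Z W S y X, D.IsKKT Z W S y X) :
    ∃ Zs Ws Ss ys Xs, D.IsKKT Zs Ws Ss ys Xs ∧ Tendsto Z atTop (𝓝 Zs) ∧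
      Tendsto W atTop (𝓝 Ws) ∧ Tendsto S atTop (𝓝 Ss) ∧ Tendsto y atTop (𝓝 ys) ∧
      Tendsto X atTop (𝓝 Xs) := by
  obtain ⟨c, κ, hc, hκ, hcκ⟩ := exists_descent_constants (E := E) D.τ_pos D.τ_lt
  obtain ⟨L, hL, hLe⟩ := D.exists_norm_le_sqrt_energy hc
  have hη0 : ∀ k, 0 ≤ η k := fun k => by
    obtain ⟨e, -, -, -, he, -⟩ := hstep k
    exact (norm_nonneg _).trans he
  have hrange : ∀ k, W (k + 1) ∈ LinearMap.range D.Q := fun k => by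
    obtain ⟨-, -, -, -, -, -, -, -, -, h, -⟩ := hstep k
    exact h
  let φ : E → E → V → E → ℕ → ℝ := fun Zs Ss ys Xs k =>
    D.energy c (Z (k + 1) - Zs) (S (k + 1) - Ss) (y (k + 1) - ys) (X (k + 1) - Xs)
      (D.res (Z (k + 1)) (W (k + 1)) (S (k + 1)) (y (k + 1))) (S (k + 1) - S k)
  let δ : ℕ → ℝ := fun k =>
    D.decrement κ (D.res (Z (k + 2)) (W (k + 2)) (S (k + 2)) (y (k + 2)))
      (Z (k + 2) - Z (k + 1)) (S (k + 2) - S (k + 1)) (y (k + 2) - y (k + 1))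
  have hdist : ∀ {Zs Ws Ss ys Xs}, D.IsKKT Zs Ws Ss ys Xs → ∀ k,
      ‖Z (k + 1) - Zs‖ + ‖W (k + 1) - Ws‖ + ‖S (k + 1) - Ss‖ + ‖y (k + 1) - ys‖
        + ‖X (k + 1) - Xs‖ ≤ L * √(φ Zs Ss ys Xs k) := by
    intro Zs Ws Ss ys Xs h k
    exact hLe _ _ _ _ _ _ _ (Submodule.sub_mem _ (hrange k) h.range)
      (h.res_eq_sub _ _ _ _)
  have hfejer : ∀ {Zs Ws Ss ys Xs}, D.IsKKT Zs Ws Ss ys Xs →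
      (∃ l, Tendsto (fun k => √(φ Zs Ss ys Xs k)) atTop (𝓝 l)) ∧ Tendsto δ atTop (𝓝 0) := by
    intro Zs Ws Ss ys Xs h
    have hη1 : Summable fun k => η (k + 1) := (summable_nat_add_iff 1).2 hη
    refine quasiFejer_tendsto (c := fun k => 4 * (η k + η (k + 1)) * L)
      (fun k => Real.sqrt_nonneg _)
      (fun k => mul_nonneg (mul_nonneg (by norm_num) (add_nonneg (hη0 _) (hη0 _))) hL)
      (fun k => D.decrement_nonneg hκ.le _ _ _ _)
      (((hη.add hη1).mul_left 4).mul_right L) (fun k => ?_)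
    rw [Real.sq_sqrt (D.energy_nonneg hc.le _ _ _ _ _ _),
      Real.sq_sqrt (D.energy_nonneg hc.le _ _ _ _ _ _)]
    refine (h.energy_descent hcκ (hstep k) (hstep (k + 1))).trans ?_
    have d1 := hdist h k
    have d2 := hdist h (k + 1)
    have n1 := norm_nonneg (X (k + 1) - Xs)
    have n2 := norm_nonneg (X (k + 1 + 1) - Xs)
    have := mul_le_mul_of_nonneg_left (add_le_add d1 d2)
      (mul_nonneg (by norm_num : (0 : ℝ) ≤ 4) (add_nonneg (hη0 k) (hη0 (k + 1))))
    have hp := mul_nonneg (mul_nonneg (by norm_num : (0 : ℝ) ≤ 4)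
      (add_nonneg (hη0 k) (hη0 (k + 1)))) (add_nonneg n1 n2)
    refine add_le_add le_rfl ?_
    linarith
  -- a subsequence converges
  obtain ⟨Z₀, W₀, S₀, y₀, X₀, h₀⟩ := hK
  obtain ⟨⟨l₀, hl₀⟩, hδ⟩ := hfejer h₀
  obtain ⟨B, hB⟩ := hl₀.bddAbove_range
  have hB' : ∀ k, L * √(φ Z₀ S₀ y₀ X₀ k) ≤ L * B := fun k =>
    mul_le_mul_of_nonneg_left (hB ⟨k, rfl⟩) hL
  let u : ℕ → E × E × E × V × E := fun k =>
    (Z (k + 2) - Z₀, W (k + 2) - W₀, S (k + 2) - S₀, y (k + 2) - y₀, X (k + 2) - X₀)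
  have hu : ∀ k, u k ∈ Metric.closedBall 0 (L * B) := by
    intro k
    rw [mem_closedBall_zero_iff]
    have h := (hdist h₀ (k + 1)).trans (hB' (k + 1))
    have j1 := norm_nonneg (Z (k + 2) - Z₀)
    have j2 := norm_nonneg (W (k + 2) - W₀)
    have j3 := norm_nonneg (S (k + 2) - S₀)
    have j4 := norm_nonneg (y (k + 2) - y₀)
    have j5 := norm_nonneg (X (k + 2) - X₀)
    simp only [u, Prod.norm_mk]
    simp only [add_assoc, Nat.reduceAdd] at h
    refine max_le (by linarith) (max_le (by linarith) (max_le (by linarith)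
      (max_le (by linarith) (by linarith))))
  obtain ⟨⟨Z₁, W₁, S₁, y₁, X₁⟩, -, ψ, hψ, hlim⟩ :=
    tendsto_subseq_of_bounded Metric.isBounded_closedBall hu
  have tZ : Tendsto (fun k => Z (ψ k + 2)) atTop (𝓝 (Z₁ + Z₀)) := by
    simpa [u] using ((continuous_fst.tendsto _).comp hlim).add_const Z₀
  have hlim2 := (continuous_snd.tendsto _).comp hlim
  have tW : Tendsto (fun k => W (ψ k + 2)) atTop (𝓝 (W₁ + W₀)) := by
    simpa [u] using ((continuous_fst.tendsto _).comp hlim2).add_const W₀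
  have hlim3 := (continuous_snd.tendsto _).comp hlim2
  have tS : Tendsto (fun k => S (ψ k + 2)) atTop (𝓝 (S₁ + S₀)) := by
    simpa [u] using ((continuous_fst.tendsto _).comp hlim3).add_const S₀
  have hlim4 := (continuous_snd.tendsto _).comp hlim3
  have ty : Tendsto (fun k => y (ψ k + 2)) atTop (𝓝 (y₁ + y₀)) := by
    simpa [u] using ((continuous_fst.tendsto _).comp hlim4).add_const y₀
  have tX : Tendsto (fun k => X (ψ k + 2)) atTop (𝓝 (X₁ + X₀)) := by
    simpa [u] using ((continuous_snd.tendsto _).comp hlim4).add_const X₀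
  generalize Z₁ + Z₀ = Zs at tZ
  generalize W₁ + W₀ = Ws at tW
  generalize S₁ + S₀ = Ss at tS
  generalize y₁ + y₀ = ys at ty
  generalize X₁ + X₀ = Xs at tX
  obtain ⟨tr, tg, tT₁, tT₂, tq⟩ := tendsto_of_decrement hκ (hδ.comp hψ.tendsto_atTop)
  have hcQ : Continuous D.Q := D.Q.continuous_of_finiteDimensional
  have hcA : Continuous D.A := D.A.continuous_of_finiteDimensional
  have hcT₁ : Continuous D.T₁ := D.T₁.continuous_of_finiteDimensional
  have hcA' : Continuous (LinearMap.adjoint D.A) :=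
    (LinearMap.adjoint D.A).continuous_of_finiteDimensional
  -- the limit is a KKT point
  have hKs : D.IsKKT Zs Ws Ss ys Xs := by
    have hη' : Tendsto (fun k => η (ψ k + 1)) atTop (𝓝 0) :=
      (hη.tendsto_atTop_zero.comp (tendsto_add_atTop_nat 1)).comp hψ.tendsto_atTop
    choose e₁ d₁ e₂ d₂ he₁ hd₁ he₂ hd₂ hZ hW hQ hS hA hX using fun k => hstep (ψ k + 1)
    have te₁ := squeeze_zero_norm he₁ hη'
    have td₁ := squeeze_zero_norm hd₁ hη'
    have te₂ := squeeze_zero_norm he₂ hη'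
    have td₂ := squeeze_zero_norm hd₂ hη'
    simp only [add_assoc, Nat.reduceAdd] at hZ hW hQ hS hA hX
    have hX' : ∀ k, X (ψ k + 1) = X (ψ k + 2) - (D.τ * D.σ) •
        D.res (Z (ψ k + 2)) (W (ψ k + 2)) (S (ψ k + 2)) (y (ψ k + 2)) := fun k => by
      rw [hX k, add_sub_cancel_right]
    have tX' : Tendsto (fun k => X (ψ k + 1)) atTop (𝓝 Xs) := by
      simp only [hX']
      simpa using tX.sub (tr.const_smul (D.τ * D.σ))
    have tY₂ : Tendsto (fun k => X (ψ k + 1) + D.σ •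
        D.res (Z (ψ k + 2)) (W (ψ k + 2)) (S (ψ k + 2)) (y (ψ k + 2))) atTop (𝓝 Xs) := by
      simpa using tX'.add (tr.const_smul D.σ)
    have hres : ∀ k, D.res (Z (ψ k + 2)) (W (ψ k + 2)) (S (ψ k + 1)) (y (ψ k + 1)) =
        D.res (Z (ψ k + 2)) (W (ψ k + 2)) (S (ψ k + 2)) (y (ψ k + 2)) -
          (S (ψ k + 2) - S (ψ k + 1)
            + LinearMap.adjoint D.A (y (ψ k + 2) - y (ψ k + 1))) := fun k => by
      simp only [res, map_sub]; abel
    have tY₁ : Tendsto (fun k => X (ψ k + 1) + D.σ •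
        D.res (Z (ψ k + 2)) (W (ψ k + 2)) (S (ψ k + 1)) (y (ψ k + 1))) atTop (𝓝 Xs) := by
      simp only [hres]
      simpa using tX'.add ((tr.sub tg).const_smul D.σ)
    refine ⟨?_, ?_, ?_, ?_, ?_, ?_⟩
    · have t := tZ.prodMk_nhds ((tY₁.add tT₁).add te₁)
      rw [add_zero, add_zero] at t
      exact D.M₁_closed.mem_of_tendsto t (Eventually.of_forall fun k => by
        simpa only [add_assoc, Nat.reduceAdd] using hZ k)
    · have t := tS.prodMk_nhds ((tY₂.add tT₂).add te₂)
      rw [add_zero, add_zero] at t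
      exact D.M₂_closed.mem_of_tendsto t (Eventually.of_forall fun k => by
        simpa only [add_assoc, Nat.reduceAdd] using hS k)
    · exact (Submodule.closed_of_finiteDimensional (LinearMap.range D.Q)).mem_of_tendsto tW
        (Eventually.of_forall hW)
    · have t1 := (hcQ.tendsto _).comp tW
      have t2 := ((hcQ.tendsto _).comp tY₁).add td₁
      rw [add_zero] at t2
      refine tendsto_nhds_unique t1 (t2.congr fun k => ?_)
      exact (hQ k).symm
    · have t1 := (hcA.tendsto _).comp tY₂
      have t2 : Tendsto (fun k => D.b + d₂ k) atTop (𝓝 (D.b + 0)) := td₂.const_add D.b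
      rw [add_zero] at t2
      exact tendsto_nhds_unique t1 (t2.congr fun k => (hA k).symm)
    · have t := (continuous_res (D := D)).tendsto (Zs, Ws, Ss, ys)
      exact tendsto_nhds_unique (t.comp (tZ.prodMk_nhds (tW.prodMk_nhds (tS.prodMk_nhds ty)))) tr
  -- the Lyapunov function relative to the limit tends to zero along the subsequence, hence fully
  obtain ⟨⟨l, hl⟩, -⟩ := hfejer hKs
  have hsub : Tendsto (fun k => φ Zs Ss ys Xs (ψ k + 1)) atTop (𝓝 0) := by
    have s1 := tendsto_sub_nhds_zero_iff.2 tX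
    have s2 := (tendsto_sub_nhds_zero_iff.2 tS).add
      ((hcA'.tendsto _).comp (tendsto_sub_nhds_zero_iff.2 ty))
    have s3 := tendsto_sub_nhds_zero_iff.2 tZ
    have s4 := tendsto_sub_nhds_zero_iff.2 tS
    have q3 := s3.inner (𝕜 := ℝ) ((hcT₁.tendsto _).comp s3)
    have q4 := s4.inner (𝕜 := ℝ)
      ((D.T₂.continuous_of_finiteDimensional.tendsto _).comp s4)
    have := ((((((s1.norm.pow 2).const_mul (D.τ * D.σ)⁻¹).add
      ((s2.norm.pow 2).const_mul D.σ)).add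
      ((tr.norm.pow 2).const_mul (c * D.σ))).add q3).add q4).add tq
    simpa [φ, energy] using this
  have hl0 : l = 0 := by
    have h1 := hl.comp ((tendsto_add_atTop_nat 1).comp hψ.tendsto_atTop)
    have h2 := hsub.sqrt
    rw [Real.sqrt_zero] at h2
    exact tendsto_nhds_unique h1 h2
  have hfin := hl.const_mul L
  rw [hl0, mul_zero] at hfin
  have hd := hdist hKs
  have m1 := fun k => norm_nonneg (Z (k + 1) - Zs)
  have m2 := fun k => norm_nonneg (W (k + 1) - Ws)
  have m3 := fun k => norm_nonneg (S (k + 1) - Ss)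
  have m4 := fun k => norm_nonneg (y (k + 1) - ys)
  have m5 := fun k => norm_nonneg (X (k + 1) - Xs)
  exact ⟨Zs, Ws, Ss, ys, Xs, hKs,
    tendsto_of_norm_succ_sub_le (fun k => by linarith [hd k, m1 k, m2 k, m3 k, m4 k, m5 k]) hfin,
    tendsto_of_norm_succ_sub_le (fun k => by linarith [hd k, m1 k, m2 k, m3 k, m4 k, m5 k]) hfin,
    tendsto_of_norm_succ_sub_le (fun k => by linarith [hd k, m1 k, m2 k, m3 k, m4 k, m5 k]) hfin,
    tendsto_of_norm_succ_sub_le (fun k => by linarith [hd k, m1 k, m2 k, m3 k, m4 k, m5 k]) hfin,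
    tendsto_of_norm_succ_sub_le (fun k => by linarith [hd k, m1 k, m2 k, m3 k, m4 k, m5 k]) hfin⟩

end SplitProblem

/-! ### Farkas' lemma and multipliers -/

/-- **Farkas' lemma**. The induction eliminates the last functional by projecting along a vector
on which only this functional is positive; no closedness of cones is needed. -/
theorem exists_nonneg_combination_of_forall_nonpos {W : Type*} [AddCommGroup W] [Module ℝ W] :
    ∀ (p : ℕ) (a : Fin p → W →ₗ[ℝ] ℝ) (g : W →ₗ[ℝ] ℝ),
      (∀ x, (∀ i, a i x ≤ 0) → g x ≤ 0) →
      ∃ l : Fin p → ℝ, (∀ i, 0 ≤ l i) ∧ g = ∑ i, l i • a i := by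
  intro p
  induction p with
  | zero =>
    intro a g h
    refine ⟨0, fun _ => le_rfl, LinearMap.ext fun x => ?_⟩
    have h1 := h x (fun i => i.elim0)
    have h2 := h (-x) (fun i => i.elim0)
    rw [map_neg] at h2
    simp only [Finset.univ_eq_empty, Finset.sum_empty, LinearMap.zero_apply]
    linarith
  | succ p ih =>
    intro a g h
    by_cases hc : ∀ x, (∀ i : Fin p, a i.castSucc x ≤ 0) → g x ≤ 0
    · obtain ⟨l, hl, hg⟩ := ih (fun i => a i.castSucc) g hc
      refine ⟨Fin.snoc l 0, fun i => ?_, ?_⟩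
      · refine Fin.lastCases ?_ (fun j => ?_) i
        · simp
        · simpa using hl j
      · rw [Fin.sum_univ_castSucc]
        simpa using hg
    · push Not at hc
      obtain ⟨x₀, hx₀, hg₀⟩ := hc
      have hlast : 0 < a (Fin.last p) x₀ := by
        by_contra! hle
        exact absurd (h x₀ (Fin.lastCases hle hx₀)) (not_le.2 hg₀)
      obtain ⟨z, hz⟩ : ∃ z, z = (a (Fin.last p) x₀)⁻¹ • x₀ := ⟨_, rfl⟩
      have hz1 : a (Fin.last p) z = 1 := by
        rw [hz, map_smul, smul_eq_mul, inv_mul_cancel₀ hlast.ne']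
      have hza : ∀ i : Fin p, a i.castSucc z ≤ 0 := fun i => by
        rw [hz, map_smul, smul_eq_mul]
        exact mul_nonpos_of_nonneg_of_nonpos (inv_pos.2 hlast).le (hx₀ i)
      have hzg : 0 < g z := by
        rw [hz, map_smul, smul_eq_mul]
        exact mul_pos (inv_pos.2 hlast) hg₀
      obtain ⟨l, hl, hg⟩ := ih
        (fun i => a i.castSucc - a i.castSucc z • a (Fin.last p))
        (g - g z • a (Fin.last p)) (fun x hx => by
          have := h (x - a (Fin.last p) x • z) (Fin.lastCases (by simp [hz1]) fun i => by
            have := hx i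
            simp only [LinearMap.sub_apply, LinearMap.smul_apply, smul_eq_mul] at this
            simp only [map_sub, map_smul, smul_eq_mul]
            linarith)
          simp only [map_sub, map_smul, smul_eq_mul] at this
          simp only [LinearMap.sub_apply, LinearMap.smul_apply, smul_eq_mul]
          linarith)
      refine ⟨Fin.snoc l (g z - ∑ i, l i * a i.castSucc z), fun i => ?_, ?_⟩
      · refine Fin.lastCases ?_ (fun j => ?_) i
        · have : ∑ i, l i * a i.castSucc z ≤ 0 :=
            Finset.sum_nonpos fun i _ => mul_nonpos_of_nonneg_of_nonpos (hl i) (hza i)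
          simp only [Fin.snoc_last]
          linarith
        · simpa using hl j
      · rw [Fin.sum_univ_castSucc]
        simp only [Fin.snoc_castSucc, Fin.snoc_last]
        ext x
        have hx := LinearMap.congr_fun hg x
        simp only [LinearMap.sub_apply, LinearMap.smul_apply, LinearMap.sum_apply, smul_eq_mul,
          mul_sub, Finset.sum_sub_distrib] at hx
        simp only [LinearMap.add_apply, LinearMap.smul_apply, LinearMap.sum_apply, smul_eq_mul,
          sub_mul, Finset.sum_mul, mul_assoc]
        linarith

section Multiplier

variable {E : Type*} [NormedAddCommGroup E] [InnerProductSpace ℝ E] [FiniteDimensional ℝ E]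

/-- Farkas' lemma relative to the kernel of a linear map: the equality constraints contribute an
element of the range of the adjoint. -/
theorem exists_sub_combination_mem_range_adjoint {V : Type*} [NormedAddCommGroup V]
    [InnerProductSpace ℝ V] [FiniteDimensional ℝ V] (A : E →ₗ[ℝ] V) {p : ℕ} (a : Fin p → E)
    (g : E) (h : ∀ x, A x = 0 → (∀ i, ⟪a i, x⟫_ℝ ≤ 0) → ⟪g, x⟫_ℝ ≤ 0) :
    ∃ (l : Fin p → ℝ) (y : V), (∀ i, 0 ≤ l i) ∧ g = ∑ i, l i • a i + LinearMap.adjoint A y := by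
  let N := LinearMap.ker A
  let φ : E → N →ₗ[ℝ] ℝ := fun v => (innerₗ E v) ∘ₗ N.subtype
  obtain ⟨l, hl, hg⟩ := exists_nonneg_combination_of_forall_nonpos p (fun i => φ (a i)) (φ g)
    (fun x hx => h x x.2 hx)
  have hmem : g - ∑ i, l i • a i ∈ Nᗮ := by
    rw [Submodule.mem_orthogonal']
    intro u hu
    have := LinearMap.congr_fun hg ⟨u, hu⟩
    simp only [φ, LinearMap.comp_apply, Submodule.subtype_apply, innerₗ_apply_apply,
      LinearMap.sum_apply, LinearMap.smul_apply, smul_eq_mul] at this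
    rw [inner_sub_left, sum_inner, this, sub_eq_zero]
    exact Finset.sum_congr rfl fun i _ => (real_inner_smul_left _ _ _).symm
  have hN : Nᗮ = LinearMap.range (LinearMap.adjoint A) := by
    rw [← Submodule.orthogonal_orthogonal (LinearMap.range (LinearMap.adjoint A)),
      LinearMap.orthogonal_range, LinearMap.adjoint_adjoint]
  rw [hN] at hmem
  obtain ⟨y, hy⟩ := hmem
  exact ⟨l, y, hl, by rw [hy]; abel⟩

/-- First-order optimality over the intersection of a cone `Ω` with `x + P`, where the cone of
directions `P` meets the interior of `Ω - x`: the linear functional splits into a part that is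
nonnegative on `P` and a part in the dual cone of `Ω` complementary to `x`. -/
theorem exists_dual_cone_multiplier {Ω P : Set E} (hΩ : Convex ℝ Ω) (h0 : (0 : E) ∈ Ω)
    (hcone : ∀ t : ℝ, 0 < t → ∀ x ∈ Ω, t • x ∈ Ω) (hP : Convex ℝ P) (hP0 : (0 : E) ∈ P)
    {x g d₀ : E} (hx : x ∈ Ω) (hd₀ : d₀ ∈ P) (hint : x + d₀ ∈ interior Ω)
    (hg : ∀ d ∈ P, x + d ∈ Ω → 0 ≤ ⟪g, d⟫_ℝ) :
    ∃ s : E, (∀ v ∈ Ω, 0 ≤ ⟪s, v⟫_ℝ) ∧ ⟪s, x⟫_ℝ = 0 ∧ ∀ d ∈ P, 0 ≤ ⟪g - s, d⟫_ℝ := by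
  have hconv : Convex ℝ ((fun d => (x + d, ⟪g, d⟫_ℝ)) '' P) := by
    rintro _ ⟨d, hd, rfl⟩ _ ⟨d', hd', rfl⟩ α β hα hβ hαβ
    refine ⟨α • d + β • d', hP hd hd' hα hβ hαβ, ?_⟩
    ext
    · simp only [Prod.fst_add, Prod.smul_fst, smul_add]
      rw [add_add_add_comm, ← add_smul, hαβ, one_smul]
    · simp [inner_add_right, inner_smul_right]
  obtain ⟨f, u, hlt, hle⟩ := geometric_hahn_banach_open
    (hΩ.interior.prod (convex_Iio (0 : ℝ))) (isOpen_interior.prod isOpen_Iio) hconv (by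
      rw [Set.disjoint_left]
      rintro _ ⟨h1, h2⟩ ⟨d, hd, rfl⟩
      exact absurd (hg d hd (interior_subset h1)) (not_le.2 h2))
  set α := f (0, 1) with hα
  set h : E →L[ℝ] ℝ := f.comp (ContinuousLinearMap.inl ℝ E ℝ) with hh
  have hf : ∀ v s, f (v, s) = h v + s * α := by
    intro v s
    have : ((v, s) : E × ℝ) = (v, 0) + s • (0, 1) := by simp
    rw [this, map_add, map_smul]
    rfl
  have hlt' : ∀ v ∈ interior Ω, ∀ s < 0, h v + s * α < u := fun v hv s hs => by
    rw [← hf]; exact hlt (v, s) ⟨hv, hs⟩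
  have hle' : ∀ d ∈ P, u ≤ h (x + d) + ⟪g, d⟫_ℝ * α := fun d hd => by
    rw [← hf]; exact hle _ ⟨d, hd, rfl⟩
  have hα0 : 0 ≤ α := by
    by_contra! hneg
    have h1 := hlt' _ hint (min (-1) ((u - h (x + d₀)) / α)) (by simp)
    have h2 := mul_le_mul_of_nonpos_right (min_le_right (-1) ((u - h (x + d₀)) / α)) hneg.le
    rw [div_mul_cancel₀ _ hneg.ne] at h2
    linarith
  have hint_le : ∀ v ∈ interior Ω, h v ≤ u := by
    intro v hv
    have ht : Tendsto (fun s : ℝ => h v + s * α) (𝓝[<] 0) (𝓝 (h v + 0 * α)) :=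
      ((continuous_const.add (continuous_id.mul continuous_const)).tendsto 0).mono_left
        nhdsWithin_le_nhds
    rw [zero_mul, add_zero] at ht
    exact le_of_tendsto ht (eventually_mem_nhdsWithin.mono fun s hs => (hlt' v hv s hs).le)
  have hΩ_le : ∀ v ∈ Ω, h v ≤ u := by
    intro v hv
    have hcl : v ∈ closure (interior Ω) := by
      rw [hΩ.closure_interior_eq_closure_of_nonempty_interior ⟨_, hint⟩]
      exact subset_closure hv
    exact closure_minimal (t := {v | h v ≤ u}) hint_le
      (isClosed_le h.continuous continuous_const) hcl
  have hu : 0 ≤ u := by simpa using hΩ_le 0 h0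
  have hΩ_nonpos : ∀ v ∈ Ω, h v ≤ 0 := by
    intro v hv
    by_contra! hpos
    have ht : 0 < (u + 1) / h v := by positivity
    have := hΩ_le _ (hcone _ ht v hv)
    rw [map_smul, smul_eq_mul, div_mul_cancel₀ _ hpos.ne'] at this
    linarith
  have hx0 : u ≤ h x := by simpa using hle' 0 hP0
  have hx1 := hΩ_nonpos x hx
  have hxz : h x = 0 := by linarith
  have hαpos : 0 < α := by
    refine lt_of_le_of_ne hα0 fun hz => ?_
    have h1 := hlt' _ hint (-1) (by norm_num)
    have h2 := hle' _ hd₀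
    rw [← hz] at h1 h2
    linarith
  set H := (InnerProductSpace.toDual ℝ E).symm h with hH
  have hHv : ∀ v, ⟪H, v⟫_ℝ = h v := fun v => InnerProductSpace.toDual_symm_apply
  refine ⟨(-α⁻¹) • H, fun v hv => ?_, ?_, fun d hd => ?_⟩
  · rw [real_inner_smul_left, hHv]
    exact mul_nonneg_of_nonpos_of_nonpos (by simpa using hαpos.le) (hΩ_nonpos v hv)
  · rw [real_inner_smul_left, hHv, hxz, mul_zero]
  · rw [inner_sub_left, real_inner_smul_left, hHv]
    have h1 := hle' d hd
    rw [map_add, hxz, zero_add] at h1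
    have h2 : 0 ≤ α⁻¹ * (h d + ⟪g, d⟫_ℝ * α) := mul_nonneg (inv_pos.2 hαpos).le (by linarith)
    have h3 : α⁻¹ * (h d + ⟪g, d⟫_ℝ * α) = ⟪g, d⟫_ℝ - -α⁻¹ * h d := by
      field_simp; ring
    linarith

end Multiplier

/-! ### The cone of positive semidefinite matrices -/

namespace SymMat

variable {n : ℕ}

/-- The rank-one matrix `v vᵀ`. -/
def outer (v : Fin n → ℝ) : SymMat n :=
  (⟨Matrix.vecMulVec v v, by
    change (Matrix.vecMulVec v v).transpose = _
    ext i j; simp [Matrix.vecMulVec_apply, mul_comm]⟩ : symMatrixSubmodule n)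

theorem outer_mat (v : Fin n → ℝ) : (outer v).mat = Matrix.vecMulVec v v := rfl

theorem inner_outer (v : Fin n → ℝ) (X : SymMat n) :
    ⟪outer v, X⟫_ℝ = v ⬝ᵥ (X.mat.mulVec v) := by
  rw [inner_def, outer_mat, Matrix.vecMulVec_mul, Matrix.trace_vecMulVec, dotProduct_comm,
    ← Matrix.dotProduct_mulVec, dotProduct_comm, dotProduct_comm]

end SymMat

section Psd

variable {n : ℕ}

theorem mem_psdCone_iff {X : SymMat n} :
    X ∈ psdCone n ↔ ∀ v : Fin n → ℝ, 0 ≤ ⟪SymMat.outer v, X⟫_ℝ := by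
  have hH : X.mat.IsHermitian := by
    have := X.mat_isSymm
    rwa [Matrix.IsHermitian, Matrix.conjTranspose_eq_transpose_of_trivial]
  change X.mat.PosSemidef ↔ _
  rw [Matrix.posSemidef_iff_dotProduct_mulVec]
  simp only [SymMat.inner_outer, hH, true_and, star_trivial]

theorem zero_mem_psdCone : (0 : SymMat n) ∈ psdCone n := by
  rw [mem_psdCone_iff]; simp

theorem smul_mem_psdCone {t : ℝ} (ht : 0 ≤ t) {X : SymMat n} (hX : X ∈ psdCone n) :
    t • X ∈ psdCone n := by
  rw [mem_psdCone_iff] at *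
  exact fun v => by rw [inner_smul_right]; exact mul_nonneg ht (hX v)

theorem convex_psdCone : Convex ℝ (psdCone n) := by
  intro X hX Y hY a b ha hb _
  rw [mem_psdCone_iff] at *
  intro v
  rw [inner_add_right, inner_smul_right, inner_smul_right]
  exact add_nonneg (mul_nonneg ha (hX v)) (mul_nonneg hb (hY v))

theorem isClosed_psdCone : IsClosed (psdCone n) := by
  have : psdCone n = ⋂ v : Fin n → ℝ, {X | 0 ≤ ⟪SymMat.outer v, X⟫_ℝ} := by
    ext X; simp [mem_psdCone_iff]
  rw [this]
  exact isClosed_iInter fun v => isClosed_le continuous_const (continuous_const.inner continuous_id)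

theorem outer_mem_psdCone (v : Fin n → ℝ) : SymMat.outer v ∈ psdCone n := by
  have := Matrix.posSemidef_vecMulVec_self_star v
  rwa [star_trivial] at this

open scoped MatrixOrder in
/-- The cone of positive semidefinite matrices is contained in its dual cone. -/
theorem inner_nonneg_of_mem_psdCone {X Y : SymMat n} (hX : X ∈ psdCone n) (hY : Y ∈ psdCone n) :
    0 ≤ ⟪X, Y⟫_ℝ := by
  obtain ⟨B, hB⟩ := CStarAlgebra.nonneg_iff_eq_star_mul_self.mp
    (show Y.mat.PosSemidef from hY).nonneg
  rw [SymMat.inner_def, hB, Matrix.star_eq_conjTranspose, ← Matrix.mul_assoc, Matrix.trace_mul_comm, ← Matrix.mul_assoc]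
  exact (Matrix.PosSemidef.mul_mul_conjTranspose_same hX B).trace_nonneg

theorem norm_outer (v : Fin n → ℝ) : ‖SymMat.outer v‖ = v ⬝ᵥ v := by
  have h0 : 0 ≤ v ⬝ᵥ v := dotProduct_self_star_nonneg (v := v)
  have : ‖SymMat.outer v‖ ^ 2 = (v ⬝ᵥ v) ^ 2 := by
    rw [← real_inner_self_eq_norm_sq, SymMat.inner_outer, SymMat.outer_mat,
      Matrix.vecMulVec_mulVec]
    simp [dotProduct_smul, sq]
  exact (sq_eq_sq₀ (norm_nonneg _) h0).1 this

/-- Positive definite matrices are bounded below on the unit sphere. -/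
theorem exists_pos_le_inner_outer {X : SymMat n} (hX : X ∈ pdCone n) :
    ∃ c : ℝ, 0 < c ∧ ∀ v : Fin n → ℝ, c * (v ⬝ᵥ v) ≤ ⟪SymMat.outer v, X⟫_ℝ := by
  have hf : Continuous fun v : EuclideanSpace ℝ (Fin n) =>
      v.ofLp ⬝ᵥ (X.mat.mulVec v.ofLp) := by
    simp only [dotProduct, Matrix.mulVec]
    fun_prop
  have hn : ∀ v : Fin n → ℝ, v ⬝ᵥ v = ‖WithLp.toLp 2 v‖ ^ 2 := fun v => by
    rw [EuclideanSpace.real_norm_sq_eq]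
    simp [dotProduct, sq]
  rcases (Metric.sphere (0 : EuclideanSpace ℝ (Fin n)) 1).eq_empty_or_nonempty with hS | hS
  -- the sphere is empty only in dimension zero, where every `v` vanishes
  · refine ⟨1, one_pos, fun v => ?_⟩
    have hv : v = 0 := by
      by_contra hv
      have hv' : WithLp.toLp 2 v ≠ 0 := by simpa using hv
      have : ‖WithLp.toLp 2 v‖⁻¹ • WithLp.toLp 2 v ∈
          Metric.sphere (0 : EuclideanSpace ℝ (Fin n)) 1 := by
        rw [mem_sphere_zero_iff_norm, norm_smul, norm_inv, norm_norm,
          inv_mul_cancel₀ (norm_ne_zero_iff.2 hv')]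
      rw [hS] at this
      exact this
    rw [SymMat.inner_outer, hv]
    simp
  · obtain ⟨v₀, hv₀, hmin⟩ := (isCompact_sphere _ _).exists_isMinOn hS hf.continuousOn
    have hpos : 0 < v₀.ofLp ⬝ᵥ (X.mat.mulVec v₀.ofLp) := by
      have : v₀.ofLp ≠ 0 := fun h => by
        have : v₀ = 0 := by ext i; simp [h]
        rw [this] at hv₀
        simp at hv₀
      simpa using (show X.mat.PosDef from hX).dotProduct_mulVec_pos this
    refine ⟨_, hpos, fun v => ?_⟩
    rw [SymMat.inner_outer]
    by_cases hv : v = 0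
    · rw [hv]; simp
    have hv' : 0 < ‖WithLp.toLp 2 v‖ := norm_pos_iff.2 (by simpa using hv)
    have hmem : ‖WithLp.toLp 2 v‖⁻¹ • WithLp.toLp 2 v ∈
        Metric.sphere (0 : EuclideanSpace ℝ (Fin n)) 1 := by
      rw [mem_sphere_zero_iff_norm, norm_smul, norm_inv, norm_norm, inv_mul_cancel₀ hv'.ne']
    have h := isMinOn_iff.1 hmin _ hmem
    simp only [WithLp.ofLp_smul, Matrix.mulVec_smul, smul_dotProduct,
      dotProduct_smul, smul_eq_mul] at h
    have h2 := mul_le_mul_of_nonneg_right h (sq_nonneg ‖WithLp.toLp 2 v‖)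
    rw [← hn v] at h2
    refine h2.trans (le_of_eq ?_)
    rw [hn v]
    field_simp

theorem pdCone_subset_interior_psdCone : pdCone n ⊆ interior (psdCone n) := by
  intro X hX
  obtain ⟨c, hc, h⟩ := exists_pos_le_inner_outer hX
  rw [mem_interior]
  refine ⟨Metric.ball X c, fun Y hY => ?_, Metric.isOpen_ball, Metric.mem_ball_self hc⟩
  rw [mem_psdCone_iff]
  intro v
  have h1 := (abs_le.1 (abs_real_inner_le_norm (SymMat.outer v) (Y - X))).1
  rw [norm_outer, inner_sub_right] at h1
  have h2 : (v ⬝ᵥ v) * ‖Y - X‖ ≤ (v ⬝ᵥ v) * c :=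
    mul_le_mul_of_nonneg_left (by rw [← dist_eq_norm]; exact (Metric.mem_ball.1 hY).le)
      (dotProduct_self_star_nonneg (v := v))
  linarith [h v]

end Psd

/-! ### Normal cones and support functions -/

section NormalRel

variable {E : Type*} [NormedAddCommGroup E] [InnerProductSpace ℝ E]

/-- The relation `x ∈ K`, `-z ∈ N_K(x)`, as a set of pairs `(z, x)`. Equivalently, `-x` is a
subgradient at `z` of `z ↦ δ*_K(-z)`. -/
def normalRel (K : Set E) : Set (E × E) :=
  {p | p.2 ∈ K ∧ ∀ x ∈ K, 0 ≤ ⟪p.1, x - p.2⟫_ℝ}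

theorem inner_sub_nonpos_of_mem_normalRel {K : Set E} {p q : E × E} (hp : p ∈ normalRel K)
    (hq : q ∈ normalRel K) : ⟪p.1 - q.1, p.2 - q.2⟫_ℝ ≤ 0 := by
  have h1 := hp.2 _ hq.1
  have h2 := hq.2 _ hp.1
  rw [inner_sub_left]
  rw [← neg_sub, inner_neg_right] at h1
  linarith

theorem isClosed_normalRel {K : Set E} (hK : IsClosed K) : IsClosed (normalRel K) := by
  have : normalRel K = Prod.snd ⁻¹' K ∩ ⋂ x ∈ K, {p : E × E | 0 ≤ ⟪p.1, x - p.2⟫_ℝ} := by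
    ext p; simp [normalRel]
  rw [this]
  refine (hK.preimage continuous_snd).inter (isClosed_biInter fun x _ => ?_)
  exact isClosed_le continuous_const
    (continuous_fst.inner (continuous_const.sub continuous_snd))

theorem inner_le_fenchelConj_indicatorFn {K : Set E} {x : E} (hx : x ∈ K) (z : E) :
    ((⟪z, x⟫_ℝ : ℝ) : EReal) ≤ fenchelConj (indicatorFn K) z :=
  le_iSup_of_le x (by simp [indicatorFn, hx])

theorem fenchelConj_indicatorFn_neg_eq {K : Set E} {z x : E} (hp : (z, x) ∈ normalRel K) :
    fenchelConj (indicatorFn K) (-z) = ((⟪-z, x⟫_ℝ : ℝ) : EReal) := by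
  refine le_antisymm (iSup_le fun w => ?_) (inner_le_fenchelConj_indicatorFn hp.1 _)
  by_cases hx : w ∈ K
  · have h : 0 ≤ ⟪z, w - x⟫_ℝ := hp.2 w hx
    rw [inner_sub_right] at h
    simp only [indicatorFn, hx, if_true, sub_zero, inner_neg_left, EReal.coe_le_coe_iff]
    linarith
  · simp [indicatorFn, hx]

theorem fenchelConj_indicatorFn_ne_bot {K : Set E} (hK : K.Nonempty) (z : E) :
    fenchelConj (indicatorFn K) z ≠ ⊥ := by
  obtain ⟨x, hx⟩ := hK
  exact ne_bot_of_le_ne_bot (EReal.coe_ne_bot _) (inner_le_fenchelConj_indicatorFn hx z)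

theorem IsPolyhedral.isClosed {K : Set E} (hK : IsPolyhedral K) : IsClosed K := by
  obtain ⟨p, a, c, rfl⟩ := hK
  simp only [Set.ofPred_forall]
  exact isClosed_iInter fun i => isClosed_le (continuous_const.inner continuous_id) continuous_const

theorem IsPolyhedral.convex {K : Set E} (hK : IsPolyhedral K) : Convex ℝ K := by
  obtain ⟨p, a, c, rfl⟩ := hK
  simp only [Set.ofPred_forall]
  exact convex_iInter fun i => convex_halfSpace_le (innerₗ E (a i)).isLinear (c i)

/-- Every point splits, by projection onto `K`, as a point of `K` minus `σ` times an element
normal to `K` there. -/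
theorem exists_add_smul_mem_normalRel [FiniteDimensional ℝ E] {K : Set E} (hne : K.Nonempty)
    (hcl : IsClosed K) (hconv : Convex ℝ K) {σ : ℝ} (hσ : 0 < σ) (u : E) :
    ∃ z, (z, u + σ • z) ∈ normalRel K := by
  obtain ⟨x, hx, hmin⟩ := exists_norm_eq_iInf_of_complete_convex hne hcl.isComplete hconv u
  rw [norm_eq_iInf_iff_real_inner_le_zero hconv hx] at hmin
  have hux : u + σ • σ⁻¹ • (x - u) = x := by
    rw [smul_smul, mul_inv_cancel₀ hσ.ne', one_smul]; abel
  refine ⟨σ⁻¹ • (x - u), ?_, fun w hw => ?_⟩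
  · simpa only [hux] using hx
  · have h := hmin w hw
    simp only [hux]
    rw [real_inner_smul_left, ← neg_sub, inner_neg_left]
    exact mul_nonneg (inv_pos.2 hσ).le (by linarith)

end NormalRel

/-- The first-order condition for minimality at `t = 0` of a quadratic polynomial on `[0, 1]`. -/
theorem nonneg_of_forall_nonneg_mul_add {l c : ℝ}
    (h : ∀ t : ℝ, 0 < t → t ≤ 1 → 0 ≤ t * l + t ^ 2 * c) : 0 ≤ l := by
  have ht : Tendsto (fun t : ℝ => l + t * c) (𝓝[>] 0) (𝓝 (l + 0 * c)) :=
    ((continuous_const.add (continuous_id.mul continuous_const)).tendsto 0).mono_left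
      nhdsWithin_le_nhds
  rw [zero_mul, add_zero] at ht
  refine ge_of_tendsto ht ?_
  filter_upwards [Ioc_mem_nhdsGT (zero_lt_one (α := ℝ))] with t ht
  have h1 := h t ht.1 ht.2
  have h2 : t * l + t ^ 2 * c = t * (l + t * c) := by ring
  rw [h2] at h1
  exact nonneg_of_mul_nonneg_right h1 ht.1

theorem eq_zero_of_forall_nonneg_mul_add {l c : ℝ}
    (h : ∀ t : ℝ, 0 ≤ t * l + t ^ 2 * c) : l = 0 := by
  refine le_antisymm ?_ (nonneg_of_forall_nonneg_mul_add fun t _ _ => h t)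
  have := nonneg_of_forall_nonneg_mul_add (l := -l) (c := c) fun t _ _ => by
    have := h (-t)
    linarith [this, neg_sq t, show -t * l + (-t) ^ 2 * c = t * -l + t ^ 2 * c by ring]
  linarith

namespace QSDP

variable {n m : ℕ} (P : QSDP n m)

/-! ### Optimality conditions of the subproblems -/

/-- The finite part of the augmented Lagrangian, without the support function and the indicator
function. -/
noncomputable def smoothPart (σ : ℝ) (Z W S : SymMat n) (y : EuclideanSpace ℝ (Fin m))
    (X : SymMat n) : ℝ :=
  (1 / 2) * ⟪W, P.Q W⟫_ℝ - ⟪P.b, y⟫_ℝ + ⟪P.residual Z W S y, X⟫_ℝ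
    + σ / 2 * ‖P.residual Z W S y‖ ^ 2

variable {P}

theorem indicatorFn_psdCone {S : SymMat n} (hS : S ∈ psdCone n) :
    indicatorFn (psdCone n) S = 0 := by
  simp [indicatorFn, hS]

theorem augLagrangian_eq {Z W S X : SymMat n} {y : EuclideanSpace ℝ (Fin m)} {σ a : ℝ}
    (hZ : P.suppK (-Z) = a) (hS : S ∈ psdCone n) :
    P.augLagrangian σ Z W S y X = ((a + P.smoothPart σ Z W S y X : ℝ) : EReal) := by
  rw [augLagrangian, lagrangian, hZ, indicatorFn_psdCone hS, add_zero, smoothPart,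
    ← EReal.coe_add, ← EReal.coe_add]
  congr 1
  ring

theorem augLagrangian_eq_suppK_add {Z W S X : SymMat n} {y : EuclideanSpace ℝ (Fin m)} {σ : ℝ}
    (hS : S ∈ psdCone n) :
    P.augLagrangian σ Z W S y X =
      P.suppK (-Z) + ((P.smoothPart σ Z W S y X : ℝ) : EReal) := by
  rw [augLagrangian, lagrangian, indicatorFn_psdCone hS, add_zero, smoothPart, add_assoc,
    ← EReal.coe_add]

theorem suppK_ne_bot (z : SymMat n) : P.suppK z ≠ ⊥ :=
  fenchelConj_indicatorFn_ne_bot P.K_nonempty z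

theorem exists_suppK_eq_coe {z : SymMat n} (hz : z ∈ effDom P.suppK) :
    ∃ a : ℝ, P.suppK z = a :=
  ⟨(P.suppK z).toReal, (EReal.coe_toReal (ne_of_lt hz) (suppK_ne_bot z)).symm⟩

/-- Expansion of the residual terms of the augmented Lagrangian along the line `r + t • v`; the
linear coefficient is the pairing of `v` with the updated multiplier `X + σ • r`. -/
theorem inner_add_norm_sq_displace (σ t : ℝ) (r v X : SymMat n) :
    ⟪r + t • v, X⟫_ℝ + σ / 2 * ‖r + t • v‖ ^ 2 =
      ⟪r, X⟫_ℝ + σ / 2 * ‖r‖ ^ 2 + t * ⟪v, X + σ • r⟫_ℝ + t ^ 2 * (σ / 2 * ‖v‖ ^ 2) := by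
  rw [norm_add_sq_real, inner_add_left, real_inner_smul_left, inner_smul_right, norm_smul,
    inner_add_right, inner_smul_right, real_inner_comm r v, mul_pow, Real.norm_eq_abs, sq_abs]
  ring

/-- Stationarity in `W`. Testing directions in the range of `Q` suffices for an equation, since
both sides lie in that range. -/
theorem argmin_W {σ : ℝ} {Z S X δ W : SymMat n} {y : EuclideanSpace ℝ (Fin m)}
    (hZ : -Z ∈ effDom P.suppK) (hS : S ∈ psdCone n) (hδ : δ ∈ P.rangeQ)
    (h : IsArgmin (fun V => P.augLagrangian σ Z V S y X - ((⟪δ, V⟫_ℝ : ℝ) : EReal)) P.rangeQ W) :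
    P.Q W = P.Q (X + σ • P.residual Z W S y) + δ := by
  obtain ⟨a, ha⟩ := exists_suppK_eq_coe hZ
  obtain ⟨hW, hmin⟩ := h
  have key : ∀ D ∈ P.rangeQ, ⟪D, P.Q W - P.Q (X + σ • P.residual Z W S y) - δ⟫_ℝ = 0 := by
    intro D hD
    refine eq_zero_of_forall_nonneg_mul_add
      (c := 1 / 2 * ⟪D, P.Q D⟫_ℝ + σ / 2 * ‖P.Q D‖ ^ 2) fun t => ?_
    have hmem : W + t • D ∈ P.rangeQ :=
      Submodule.add_mem (LinearMap.range P.Q) hW (Submodule.smul_mem _ t hD)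
    have h1 := isMinOn_iff.1 hmin _ hmem
    simp only [augLagrangian_eq ha hS] at h1
    rw [← EReal.coe_sub, ← EReal.coe_sub, EReal.coe_le_coe_iff] at h1
    have hr : P.residual Z (W + t • D) S y = P.residual Z W S y + t • (-P.Q D) := by
      simp only [residual, map_add, map_smul, smul_neg]; abel
    have h2 := inner_add_norm_sq_displace σ t (P.residual Z W S y) (-P.Q D) X
    rw [smoothPart, smoothPart, hr] at h1
    rw [norm_neg, inner_neg_left, P.Q_pos.isSymmetric] at h2
    have hsym : ⟪W, P.Q D⟫_ℝ = ⟪D, P.Q W⟫_ℝ := by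
      rw [← P.Q_pos.isSymmetric, real_inner_comm]
    have h3 : ⟪W + t • D, P.Q (W + t • D)⟫_ℝ =
        ⟪W, P.Q W⟫_ℝ + 2 * t * ⟪D, P.Q W⟫_ℝ + t ^ 2 * ⟪D, P.Q D⟫_ℝ := by
      simp only [map_add, map_smul, inner_add_left, inner_add_right, real_inner_smul_left,
        inner_smul_right, hsym]
      ring
    have h4 : ⟪δ, W + t • D⟫_ℝ = ⟪δ, W⟫_ℝ + t * ⟪D, δ⟫_ℝ := by
      rw [inner_add_right, inner_smul_right, real_inner_comm D]
    rw [inner_sub_right, inner_sub_right]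
    linarith
  have hmem : P.Q W - P.Q (X + σ • P.residual Z W S y) - δ ∈ P.rangeQ :=
    Submodule.sub_mem (LinearMap.range P.Q)
      (Submodule.sub_mem _ (LinearMap.mem_range_self _ _) (LinearMap.mem_range_self _ _)) hδ
  have := inner_self_eq_zero.1 (key _ hmem)
  rw [sub_eq_zero, sub_eq_iff_eq_add] at this
  rw [this, add_comm]

theorem argmin_y {σ : ℝ} {Z W S X : SymMat n} {δ y : EuclideanSpace ℝ (Fin m)}
    (hZ : -Z ∈ effDom P.suppK) (hS : S ∈ psdCone n)
    (h : IsArgmin (fun v => P.augLagrangian σ Z W S v X - ((⟪δ, v⟫_ℝ : ℝ) : EReal)) Set.univ y) :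
    P.A (X + σ • P.residual Z W S y) = P.b + δ := by
  obtain ⟨a, ha⟩ := exists_suppK_eq_coe hZ
  have key : ∀ d, ⟪d, P.A (X + σ • P.residual Z W S y) - P.b - δ⟫_ℝ = 0 := by
    intro d
    refine eq_zero_of_forall_nonneg_mul_add (c := σ / 2 * ‖P.Aadj d‖ ^ 2) fun t => ?_
    have h1 := isMinOn_iff.1 h.2 (y + t • d) (Set.mem_univ _)
    simp only [augLagrangian_eq ha hS] at h1
    rw [← EReal.coe_sub, ← EReal.coe_sub, EReal.coe_le_coe_iff] at h1
    have hr : P.residual Z W S (y + t • d) = P.residual Z W S y + t • P.Aadj d := by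
      simp only [residual, map_add, map_smul]; abel
    have h2 := inner_add_norm_sq_displace σ t (P.residual Z W S y) (P.Aadj d) X
    have h5 : ⟪P.Aadj d, X + σ • P.residual Z W S y⟫_ℝ =
        ⟪d, P.A (X + σ • P.residual Z W S y)⟫_ℝ := LinearMap.adjoint_inner_left _ _ _
    rw [h5] at h2
    rw [smoothPart, smoothPart, hr] at h1
    have h3 : ⟪P.b, y + t • d⟫_ℝ = ⟪P.b, y⟫_ℝ + t * ⟪d, P.b⟫_ℝ := by
      rw [inner_add_right, inner_smul_right, real_inner_comm d]
    have h4 : ⟪δ, y + t • d⟫_ℝ = ⟪δ, y⟫_ℝ + t * ⟪d, δ⟫_ℝ := by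
      rw [inner_add_right, inner_smul_right, real_inner_comm d]
    rw [inner_sub_right, inner_sub_right]
    linarith
  have := inner_self_eq_zero.1 (key _)
  rw [sub_sub, sub_eq_zero] at this
  exact this

/-- The variational inequality in `S`; finiteness of the minimum forces `S` to be positive
semidefinite. -/
theorem argmin_S {σ : ℝ} {Z W S X : SymMat n} {y : EuclideanSpace ℝ (Fin m)}
    (hZ : -Z ∈ effDom P.suppK)
    (h : IsArgmin (fun V => P.augLagrangian σ Z W V y X) Set.univ S) :
    S ∈ psdCone n ∧ ∀ V ∈ psdCone n, 0 ≤ ⟪X + σ • P.residual Z W S y, V - S⟫_ℝ := by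
  obtain ⟨a, ha⟩ := exists_suppK_eq_coe hZ
  have hmin := isMinOn_iff.1 h.2
  have hS : S ∈ psdCone n := by
    by_contra hS
    have h0 := hmin 0 (Set.mem_univ _)
    simp only [augLagrangian_eq ha zero_mem_psdCone] at h0
    have htop : P.augLagrangian σ Z W S y X = ⊤ := by
      rw [augLagrangian, lagrangian, ha, indicatorFn, if_neg hS, EReal.coe_add_top,
        EReal.top_add_coe, EReal.top_add_coe]
    rw [htop, top_le_iff] at h0
    exact EReal.coe_ne_top _ h0
  refine ⟨hS, fun V hV => ?_⟩
  refine nonneg_of_forall_nonneg_mul_add (c := σ / 2 * ‖V - S‖ ^ 2) fun t ht0 ht1 => ?_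
  have hmem : S + t • (V - S) ∈ psdCone n := convex_psdCone.add_smul_sub_mem hS hV ⟨ht0.le, ht1⟩
  have h1 := hmin (S + t • (V - S)) (Set.mem_univ _)
  simp only [augLagrangian_eq ha hmem, augLagrangian_eq ha hS] at h1
  rw [EReal.coe_le_coe_iff] at h1
  have hr : P.residual Z W (S + t • (V - S)) y = P.residual Z W S y + t • (V - S) := by
    simp only [residual]; abel
  have h2 := inner_add_norm_sq_displace σ t (P.residual Z W S y) (V - S) X
  rw [smoothPart, smoothPart, hr] at h1
  rw [real_inner_comm]
  linarith

/-- The explicit solution given by the projection onto `K` is the unique minimizer, since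
replacing the support function by its affine minorant at that solution leaves a strictly convex
quadratic with the same minimizer. -/
theorem argmin_Z {σ : ℝ} (hσ : 0 < σ) {Z W S X : SymMat n} {y : EuclideanSpace ℝ (Fin m)}
    (hS : S ∈ psdCone n)
    (h : IsArgmin (fun V => P.augLagrangian σ V W S y X) Set.univ Z) :
    (Z, X + σ • P.residual Z W S y) ∈ normalRel P.K := by
  obtain ⟨Z₀, hZ₀⟩ := exists_add_smul_mem_normalRel P.K_nonempty P.K_polyhedral.isClosed
    P.K_polyhedral.convex hσ (X + σ • P.residual 0 W S y)
  have hr0 : X + σ • P.residual 0 W S y + σ • Z₀ = X + σ • P.residual Z₀ W S y := by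
    rw [add_assoc, ← smul_add]
    congr 2
    simp only [residual]; abel
  rw [hr0] at hZ₀
  have hs₀ : P.suppK (-Z₀) = ((⟪-Z₀, X + σ • P.residual Z₀ W S y⟫_ℝ : ℝ) : EReal) :=
    fenchelConj_indicatorFn_neg_eq hZ₀
  have h1 : P.augLagrangian σ Z W S y X ≤ P.augLagrangian σ Z₀ W S y X :=
    isMinOn_iff.1 h.2 Z₀ (Set.mem_univ _)
  rw [augLagrangian_eq hs₀ hS, augLagrangian_eq_suppK_add hS] at h1
  have hle : ((⟪-Z, X + σ • P.residual Z₀ W S y⟫_ℝ : ℝ) : EReal) ≤ P.suppK (-Z) :=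
    inner_le_fenchelConj_indicatorFn hZ₀.1 (-Z)
  have h2 := (add_le_add_left hle ((P.smoothPart σ Z W S y X : ℝ) : EReal)).trans h1
  rw [← EReal.coe_add, EReal.coe_le_coe_iff] at h2
  have hr : P.residual Z W S y = P.residual Z₀ W S y + (1 : ℝ) • (Z - Z₀) := by
    simp only [residual, one_smul]; abel
  have h3 := inner_add_norm_sq_displace σ 1 (P.residual Z₀ W S y) (Z - Z₀) X
  rw [smoothPart, smoothPart, hr] at h2
  simp only [inner_neg_left] at h2
  rw [inner_sub_left] at h3
  have h4 : σ / 2 * ‖Z - Z₀‖ ^ 2 ≤ 0 := by linarith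
  have h5 : ‖Z - Z₀‖ ^ 2 ≤ 0 := by
    by_contra! hpos
    have : 0 < σ / 2 * ‖Z - Z₀‖ ^ 2 := by positivity
    linarith
  have h6 : Z = Z₀ := by
    have := pow_eq_zero_iff (two_ne_zero) |>.1 (le_antisymm h5 (sq_nonneg _))
    exact sub_eq_zero.1 (norm_eq_zero.1 this)
  rw [h6]
  exact hZ₀

theorem neg_mem_effDom_of_mem_normalRel {Z X : SymMat n} (h : (Z, X) ∈ normalRel P.K) :
    -Z ∈ effDom P.suppK := by
  have hs : P.suppK (-Z) = _ := fenchelConj_indicatorFn_neg_eq h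
  rw [effDom, Set.mem_ofPred_eq, hs]
  exact EReal.coe_lt_top _

end QSDP

/-! ### Eliminating the auxiliary half-steps -/

theorem LinearMap.exists_nonneg_bound {V F : Type*} [NormedAddCommGroup V] [NormedSpace ℝ V]
    [FiniteDimensional ℝ V] [NormedAddCommGroup F] [NormedSpace ℝ F] (f : V →ₗ[ℝ] F) :
    ∃ L : ℝ, 0 ≤ L ∧ ∀ x, ‖f x‖ ≤ L * ‖x‖ :=
  ⟨‖f.toContinuousLinearMap‖, norm_nonneg _, f.toContinuousLinearMap.le_opNorm⟩

section SchurComplement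

variable {E V : Type*} [NormedAddCommGroup E] [InnerProductSpace ℝ E] [FiniteDimensional ℝ E]
  [NormedAddCommGroup V] [InnerProductSpace ℝ V] [FiniteDimensional ℝ V]

/-- The proximal operator `T = σ² (1 + σ Q)⁻¹ Q` produced by solving for `W` twice: `D` stands for
`Q` applied to the difference of the two solutions, `u` for the change of `Z` in between. -/
theorem exists_proximal_of_isPositive {Q : E →ₗ[ℝ] E} (hQ : Q.IsPositive) {σ : ℝ} (hσ : 0 < σ) :
    ∃ T : E →ₗ[ℝ] E, T.IsPositive ∧ (∀ x, ‖T x‖ ^ 2 ≤ σ * ⟪x, T x⟫_ℝ) ∧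
      (∀ x, T x = 0 → Q x = 0) ∧
      ∃ L : ℝ, 0 ≤ L ∧ ∀ D u e, D + σ • Q D = σ • Q u + e → ‖σ • D - T u‖ ≤ L * ‖e‖ := by
  have hinj : Function.Injective (LinearMap.id + σ • Q : E →ₗ[ℝ] E) := by
    rw [← LinearMap.ker_eq_bot, LinearMap.ker_eq_bot']
    intro x hx
    have h1 : ⟪x, x + σ • Q x⟫_ℝ = 0 := by
      rw [show x + σ • Q x = (LinearMap.id + σ • Q : E →ₗ[ℝ] E) x from rfl, hx, inner_zero_right]
    rw [inner_add_right, inner_smul_right] at h1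
    have h2 := mul_nonneg hσ.le (hQ.inner_nonneg_right x)
    have h3 : 0 ≤ ⟪x, x⟫_ℝ := real_inner_self_nonneg
    exact inner_self_eq_zero.1 (le_antisymm (by linarith) h3)
  let G := LinearEquiv.ofInjectiveEndo _ hinj
  have hG : ∀ x, G x = x + σ • Q x := fun x => rfl
  let J : E →ₗ[ℝ] E := G.symm.toLinearMap
  have hJ : ∀ x, J (x + σ • Q x) = x := fun x => G.symm_apply_apply x
  obtain ⟨L, hL, hLb⟩ := J.exists_nonneg_bound
  have hT : ∀ u, J (Q (G u)) = Q u := fun u => by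
    rw [hG, map_add, map_smul, hJ]
  have hpos : ∀ u, σ * ‖Q u‖ ^ 2 ≤ ⟪G u, J (Q (G u))⟫_ℝ := fun u => by
    rw [hT, hG, inner_add_left, real_inner_smul_left, real_inner_self_eq_norm_sq]
    linarith [hQ.inner_nonneg_right u]
  refine ⟨σ ^ 2 • (J ∘ₗ Q), ⟨fun x y => ?_, fun x => ?_⟩, fun x => ?_, fun x hx => ?_,
    σ * L, by positivity, fun D u e h => ?_⟩
  · obtain ⟨u, rfl⟩ := G.surjective x
    obtain ⟨v, rfl⟩ := G.surjective y
    simp only [LinearMap.smul_apply, LinearMap.comp_apply, hT, real_inner_smul_left,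
      inner_smul_right]
    rw [hG, hG, inner_add_left, inner_add_right, real_inner_smul_left, inner_smul_right,
      hQ.isSymmetric u v]
  · obtain ⟨u, rfl⟩ := G.surjective x
    simp only [LinearMap.smul_apply, LinearMap.comp_apply, real_inner_smul_left, RCLike.re_to_real]
    rw [real_inner_comm]
    have h1 := hpos u
    have h2 : 0 ≤ σ * ‖Q u‖ ^ 2 := by positivity
    have h3 : 0 ≤ ⟪G u, J (Q (G u))⟫_ℝ := by linarith
    positivity
  · obtain ⟨u, rfl⟩ := G.surjective x
    have h1 := mul_le_mul_of_nonneg_left (hpos u) (by positivity : 0 ≤ σ ^ 3)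
    simp only [LinearMap.smul_apply, LinearMap.comp_apply, inner_smul_right, norm_smul]
    rw [hT] at h1 ⊢
    rw [mul_pow, Real.norm_eq_abs, sq_abs]
    linarith
  · simp only [LinearMap.smul_apply, LinearMap.comp_apply, smul_eq_zero] at hx
    have h1 : J (Q x) = 0 := hx.resolve_left (by positivity)
    exact G.symm.map_eq_zero_iff.1 h1
  · have h1 : D = J (σ • Q u + e) := by rw [← h, hJ]
    have h2 : σ • D - (σ ^ 2 • (J ∘ₗ Q)) u = σ • J e := by
      rw [h1]
      simp only [LinearMap.smul_apply, LinearMap.comp_apply, map_add, map_smul]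
      module
    rw [h2, norm_smul, Real.norm_eq_abs, abs_of_pos hσ, mul_assoc]
    exact mul_le_mul_of_nonneg_left (hLb e) hσ.le

/-- The proximal operator `T = σ A* (A A*)⁻¹ A` produced by solving for `y` twice: `v` is the
difference of the two solutions, `s` the change of `S` in between. -/
theorem exists_proximal_of_surjective {A : E →ₗ[ℝ] V} (hA : Function.Surjective A) {σ : ℝ}
    (hσ : 0 < σ) :
    ∃ T : E →ₗ[ℝ] E, T.IsPositive ∧ (∀ x, ‖T x‖ ^ 2 ≤ σ * ⟪x, T x⟫_ℝ) ∧
      (∀ x, T x = 0 → A x = 0) ∧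
      ∃ L : ℝ, 0 ≤ L ∧ ∀ s v e, σ • A (s + LinearMap.adjoint A v) = e →
        ‖-(σ • LinearMap.adjoint A v) - T s‖ ≤ L * ‖e‖ := by
  have hAd : ∀ v, LinearMap.adjoint A v = 0 → v = 0 := fun v hv => by
    obtain ⟨x, rfl⟩ := hA v
    rw [← inner_self_eq_zero (𝕜 := ℝ), ← LinearMap.adjoint_inner_right, hv, inner_zero_right]
  have hinj : Function.Injective (A ∘ₗ LinearMap.adjoint A) := by
    rw [← LinearMap.ker_eq_bot, LinearMap.ker_eq_bot']
    intro v hv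
    refine hAd v ?_
    rw [← inner_self_eq_zero (𝕜 := ℝ), LinearMap.adjoint_inner_left]
    rw [show A (LinearMap.adjoint A v) = 0 from hv, inner_zero_right]
  let G := LinearEquiv.ofInjectiveEndo _ hinj
  let B : V →ₗ[ℝ] V := G.symm.toLinearMap
  have hB : ∀ v, B (A (LinearMap.adjoint A v)) = v := fun v => G.symm_apply_apply v
  have hB' : ∀ v, A (LinearMap.adjoint A (B v)) = v := fun v => G.apply_symm_apply v
  have hBsym : ∀ u v, ⟪B u, v⟫_ℝ = ⟪u, B v⟫_ℝ := fun u v => by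
    conv_lhs => rw [← hB' v]
    conv_rhs => rw [← hB' u]
    rw [← LinearMap.adjoint_inner_left A, ← LinearMap.adjoint_inner_right A]
  obtain ⟨L, hL, hLb⟩ := (LinearMap.adjoint A ∘ₗ B).exists_nonneg_bound
  have hin : ∀ x y, ⟪LinearMap.adjoint A (B (A x)), y⟫_ℝ = ⟪B (A x), A y⟫_ℝ := fun x y =>
    LinearMap.adjoint_inner_left _ _ _
  have hsq : ∀ x, ‖LinearMap.adjoint A (B (A x))‖ ^ 2 = ⟪B (A x), A x⟫_ℝ := fun x => by
    rw [← real_inner_self_eq_norm_sq, hin, hB']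
  refine ⟨σ • (LinearMap.adjoint A ∘ₗ B ∘ₗ A), ⟨fun x y => ?_, fun x => ?_⟩, fun x => ?_,
    fun x hx => ?_, L, hL, fun s v e h => ?_⟩
  · simp only [LinearMap.smul_apply, LinearMap.comp_apply, real_inner_smul_left, inner_smul_right,
      hin, hBsym]
    rw [LinearMap.adjoint_inner_right]
  · simp only [LinearMap.smul_apply, LinearMap.comp_apply, real_inner_smul_left, RCLike.re_to_real]
    rw [hin, ← hsq]
    positivity
  · simp only [LinearMap.smul_apply, LinearMap.comp_apply, inner_smul_right, norm_smul]
    rw [real_inner_comm, hin, ← hsq, mul_pow, Real.norm_eq_abs, sq_abs]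
    linarith
  · simp only [LinearMap.smul_apply, LinearMap.comp_apply, smul_eq_zero, hσ.ne', false_or] at hx
    rw [← hB' (A x), hx, map_zero]
  · have h1 : -(σ • LinearMap.adjoint A v) - (σ • (LinearMap.adjoint A ∘ₗ B ∘ₗ A)) s =
        -(LinearMap.adjoint A ∘ₗ B) e := by
      rw [← h]
      simp only [LinearMap.smul_apply, LinearMap.comp_apply, map_add, map_smul, hB, smul_add]
      abel
    rw [h1, norm_neg]
    exact hLb e

end SchurComplement

namespace QSDP

variable {n m : ℕ} (P : QSDP n m)

theorem SlaterCondition.surjective {P : QSDP n m} (h : P.SlaterCondition) :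
    Function.Surjective P.A := by
  obtain ⟨X, -, -, hX⟩ := h
  intro y
  obtain ⟨x, -, hx⟩ := hX.symm ▸ Set.mem_univ y
  exact ⟨x, hx⟩

/-- The two-block problem with blocks `(Z, W)` and `(S, y)` whose semi-proximal ADMM is the given
algorithm. -/
noncomputable def splitProblem (hA : Function.Surjective P.A) {σ τ : ℝ} (hσ : 0 < σ) (hτ : 0 < τ)
    (hτ' : τ < (1 + √5) / 2) : SplitProblem (SymMat n) (EuclideanSpace ℝ (Fin m)) where
  Q := P.Q
  A := P.A
  T₁ := (exists_proximal_of_isPositive P.Q_pos hσ).choose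
  T₂ := (exists_proximal_of_surjective hA hσ).choose
  M₁ := normalRel P.K
  M₂ := Prod.swap ⁻¹' normalRel (psdCone n)
  C := P.C
  b := P.b
  σ := σ
  τ := τ
  Q_pos := P.Q_pos
  A_surj := hA
  T₁_pos := (exists_proximal_of_isPositive P.Q_pos hσ).choose_spec.1
  T₂_pos := (exists_proximal_of_surjective hA hσ).choose_spec.1
  T₁_sq := (exists_proximal_of_isPositive P.Q_pos hσ).choose_spec.2.1
  T₂_sq := (exists_proximal_of_surjective hA hσ).choose_spec.2.1
  T₁_ker := (exists_proximal_of_isPositive P.Q_pos hσ).choose_spec.2.2.1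
  T₂_ker := (exists_proximal_of_surjective hA hσ).choose_spec.2.2.1
  M₁_closed := isClosed_normalRel P.K_polyhedral.isClosed
  M₂_closed := (isClosed_normalRel isClosed_psdCone).preimage continuous_swap
  M₁_anti := fun p hp q hq => inner_sub_nonpos_of_mem_normalRel (p := p) (q := q) hp hq
  M₂_anti := fun p hp q hq => by
    rw [real_inner_comm]
    exact inner_sub_nonpos_of_mem_normalRel (p := p.swap) (q := q.swap) hp hq
  σ_pos := hσ
  τ_pos := hτ
  τ_lt := hτ'

variable {P} {σ τ : ℝ} {hA : Function.Surjective P.A} {hσ : 0 < σ} {hτ : 0 < τ}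
  {hτ' : τ < (1 + √5) / 2}

/-- One iteration of the algorithm is one perturbed step of the two-block method, with a
perturbation proportional to the tolerance. -/
theorem exists_step_of_phaseIStep :
    ∃ L : ℝ, 0 ≤ L ∧ ∀ {ε : ℝ} {Z W S X Z' W' S' X' : SymMat n}
      {y y' : EuclideanSpace ℝ (Fin m)}, -Z ∈ effDom P.suppK → S ∈ psdCone n →
      P.PhaseIStep σ τ ε Z W S y X Z' W' S' y' X' →
      -Z' ∈ effDom P.suppK ∧ S' ∈ psdCone n ∧
      (P.splitProblem hA hσ hτ hτ').Step (L * ε) Z S y X Z' W' S' y' X' := by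
  obtain ⟨L₁, hL₁, h₁⟩ := (exists_proximal_of_isPositive P.Q_pos hσ).choose_spec.2.2.2
  obtain ⟨L₂, hL₂, h₂⟩ := (exists_proximal_of_surjective hA hσ).choose_spec.2.2.2
  change ∀ D u e, _ → ‖σ • D - (P.splitProblem hA hσ hτ hτ').T₁ u‖ ≤ _ at h₁
  change ∀ s v e, _ → ‖_ - (P.splitProblem hA hσ hτ hτ').T₂ s‖ ≤ _ at h₂
  refine ⟨1 + 2 * L₁ + 2 * L₂, by positivity, ?_⟩
  rintro ε Z W S X Z' W' S' X' y y' hZ hS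
    ⟨What, yhat, dQh, dQ, dyh, dy, hdQh, hdQ, hmax, hWh, hZ', hW', hyh, hS', hy', hX'⟩
  obtain ⟨⟨b1, b2⟩, b3, b4⟩ := (max_le_iff.1 hmax).imp max_le_iff.1 max_le_iff.1
  have hε : 0 ≤ ε := (norm_nonneg _).trans b1
  have aWh := argmin_W hZ hS hdQh hWh
  have aZ := argmin_Z hσ hS hZ'
  have dZ := neg_mem_effDom_of_mem_normalRel aZ
  have aW := argmin_W dZ hS hdQ hW'
  have ayh := argmin_y dZ hS hyh
  obtain ⟨pS, aS⟩ := argmin_S dZ hS'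
  have ay := argmin_y dZ pS hy'
  -- the difference of the two solves for `W` is the proximal term in `Z` up to the errors
  have eW := h₁ (P.Q (W' - What)) (Z' - Z) (dQ - dQh) (by
    have e1 : P.Q (W' - What) = P.Q (σ • (P.residual Z' W' S y - P.residual Z What S y))
        + (dQ - dQh) := by
      rw [map_sub, aW, aWh]
      simp only [map_add, map_sub, map_smul, smul_sub]
      abel
    have e2 : P.residual Z' W' S y - P.residual Z What S y = (Z' - Z) - P.Q (W' - What) := by
      simp only [residual, map_sub]; abel
    rw [e2, map_smul, map_sub P.Q (Z' - Z)] at e1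
    nth_rewrite 1 [e1]
    rw [smul_sub]
    abel)
  -- the difference of the two solves for `y` is the proximal term in `S` up to the errors
  have ey := h₂ (S' - S) (y' - yhat) (dy - dyh) (by
    have e1 : dy - dyh = P.A (σ • (P.residual Z' W' S' y' - P.residual Z' W' S yhat)) := by
      have e3 : dy - dyh = P.A (X + σ • P.residual Z' W' S' y')
          - P.A (X + σ • P.residual Z' W' S yhat) := by rw [ay, ayh]; abel
      rw [e3, ← map_sub, smul_sub]
      congr 1; abel
    have e2 : P.residual Z' W' S' y' - P.residual Z' W' S yhat =
        (S' - S) + LinearMap.adjoint P.A (y' - yhat) := by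
      simp only [residual, Aadj, map_sub]; abel
    rw [e1, e2, map_smul])
  have n1 : ‖dQ - dQh‖ ≤ 2 * ε := (norm_sub_le _ _).trans (by linarith)
  have n2 : ‖dy - dyh‖ ≤ 2 * ε := (norm_sub_le _ _).trans (by linarith)
  have n3 := eW.trans (mul_le_mul_of_nonneg_left n1 hL₁)
  have n4 := ey.trans (mul_le_mul_of_nonneg_left n2 hL₂)
  have p1 := mul_nonneg hL₁ hε
  have p2 := mul_nonneg hL₂ hε
  refine ⟨dZ, pS, _, dQ, _, dy, n3.trans (by linarith), b3.trans (by linarith),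
    n4.trans (by linarith), b1.trans (by linarith), ?_, hW'.1, aW, ?_, ay, hX'⟩
  · have e : X + σ • P.residual Z' W' S y + (P.splitProblem hA hσ hτ hτ').T₁ (Z' - Z)
        + (σ • P.Q (W' - What) - (P.splitProblem hA hσ hτ hτ').T₁ (Z' - Z)) =
        X + σ • P.residual Z' What S y := by
      simp only [residual, map_sub, smul_sub, smul_add]; abel
    have := aZ
    rw [← e] at this
    exact this
  · have e : X + σ • P.residual Z' W' S' y' + (P.splitProblem hA hσ hτ hτ').T₂ (S' - S)
        + (-(σ • LinearMap.adjoint P.A (y' - yhat))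
          - (P.splitProblem hA hσ hτ hτ').T₂ (S' - S)) =
        X + σ • P.residual Z' W' S' yhat := by
      simp only [residual, Aadj, map_sub, smul_sub, smul_add]; abel
    have : (X + σ • P.residual Z' W' S' yhat, S') ∈ normalRel (psdCone n) := ⟨pS, aS⟩
    rw [← e] at this
    exact this

end QSDP

namespace QSDP

variable {n m : ℕ} {P : QSDP n m} {σ τ : ℝ} {hA : Function.Surjective P.A} {hσ : 0 < σ}
  {hτ : 0 < τ} {hτ' : τ < (1 + √5) / 2}

/-! ### Existence and sufficiency of the Karush–Kuhn–Tucker conditions -/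

theorem primalObj_add_smul (X D : SymMat n) (t : ℝ) :
    P.primalObj (X + t • D) =
      P.primalObj X + t * ⟪P.Q X + P.C, D⟫_ℝ + t ^ 2 * (1 / 2 * ⟪D, P.Q D⟫_ℝ) := by
  have h1 : ⟪X, P.Q D⟫_ℝ = ⟪P.Q X, D⟫_ℝ := (P.Q_pos.isSymmetric X D).symm
  have h2 : ⟪D, P.Q X⟫_ℝ = ⟪P.Q X, D⟫_ℝ := real_inner_comm _ _
  simp only [primalObj, map_add, map_smul, inner_add_left, inner_add_right, real_inner_smul_left,
    inner_smul_right, h1, h2]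
  ring

/-- At a primal solution the linearized objective is nonnegative along every direction that stays
in the linearization of the affine and polyhedral constraints and reaches the semidefinite cone
with a full step. -/
theorem inner_gradient_nonneg {X D : SymMat n} (hX : X ∈ P.primalSolutions) {p : ℕ}
    {a : Fin p → SymMat n} {c : Fin p → ℝ} (hK : P.K = {x | ∀ i, ⟪a i, x⟫_ℝ ≤ c i})
    (hAD : P.A D = 0) (haD : ∀ i, ⟪a i, X⟫_ℝ = c i → ⟪a i, D⟫_ℝ ≤ 0)
    (hXD : X + D ∈ psdCone n) : 0 ≤ ⟪P.Q X + P.C, D⟫_ℝ := by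
  obtain ⟨⟨hAX, hpsd, hXK⟩, hopt⟩ := hX
  have hXa : ∀ i, ⟪a i, X⟫_ℝ ≤ c i := by rw [hK] at hXK; exact hXK
  -- inactive constraints stay satisfied for small steps
  have hev : ∀ᶠ t in 𝓝[>] (0 : ℝ), ∀ i, ⟪a i, X + t • D⟫_ℝ ≤ c i := by
    rw [eventually_all]
    intro i
    rcases (hXa i).eq_or_lt with heq | hlt
    · filter_upwards [self_mem_nhdsWithin] with t ht
      rw [inner_add_right, inner_smul_right, heq]
      have := mul_nonpos_of_nonneg_of_nonpos (le_of_lt ht) (haD i heq)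
      linarith
    · have hcont : Tendsto (fun t : ℝ => ⟪a i, X + t • D⟫_ℝ) (𝓝[>] 0)
          (𝓝 ⟪a i, X + (0 : ℝ) • D⟫_ℝ) :=
        ((continuous_const.inner
          (continuous_const.add (continuous_id.smul continuous_const))).tendsto 0).mono_left
          nhdsWithin_le_nhds
      rw [zero_smul, add_zero] at hcont
      exact (hcont.eventually_lt_const hlt).mono fun t ht => ht.le
  have ht : Tendsto (fun t : ℝ => ⟪P.Q X + P.C, D⟫_ℝ + t * (1 / 2 * ⟪D, P.Q D⟫_ℝ)) (𝓝[>] 0)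
      (𝓝 (⟪P.Q X + P.C, D⟫_ℝ + 0 * (1 / 2 * ⟪D, P.Q D⟫_ℝ))) :=
    ((continuous_const.add (continuous_id.mul continuous_const)).tendsto 0).mono_left
      nhdsWithin_le_nhds
  rw [zero_mul, add_zero] at ht
  refine ge_of_tendsto ht ?_
  filter_upwards [hev, Ioc_mem_nhdsGT (zero_lt_one (α := ℝ))] with t h1 ht
  have hfeas : X + t • D ∈ P.primalFeasible := by
    refine ⟨by rw [map_add, map_smul, hAD, smul_zero, add_zero, hAX], ?_, by rw [hK]; exact h1⟩
    have := convex_psdCone.add_smul_sub_mem hpsd hXD ⟨ht.1.le, ht.2⟩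
    rwa [add_sub_cancel_left] at this
  have h2 := hopt _ hfeas
  rw [primalObj_add_smul] at h2
  have h3 : 0 ≤ t * (⟪P.Q X + P.C, D⟫_ℝ + t * (1 / 2 * ⟪D, P.Q D⟫_ℝ)) := by linarith
  exact nonneg_of_mul_nonneg_right h3 ht.1

/-- Under the Slater condition every primal solution has multipliers. The semidefinite constraint
is separated off by Hahn–Banach, and the remaining affine and polyhedral constraints are treated
by Farkas' lemma. -/
theorem exists_multipliers (hslater : P.SlaterCondition) {X : SymMat n}
    (hX : X ∈ P.primalSolutions) :
    ∃ (Z S : SymMat n) (y : EuclideanSpace ℝ (Fin m)), (Z, X) ∈ normalRel P.K ∧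
      (X, S) ∈ normalRel (psdCone n) ∧ P.Q X + P.C = Z + S + P.Aadj y := by
  obtain ⟨p, a, c, hK⟩ := P.K_polyhedral
  have hXK : ∀ i, ⟪a i, X⟫_ℝ ≤ c i := by
    have := hX.1.2.2
    rw [hK] at this
    exact this
  obtain ⟨X₁, hAX₁, ⟨hpd, hri⟩, -⟩ := hslater
  have hX₁K : ∀ i, ⟪a i, X₁⟫_ℝ ≤ c i := by
    have := intrinsicInterior_subset hri
    rw [hK] at this
    exact this
  classical
  -- the inactive constraints are switched off by replacing their normals by zero
  let a' : Fin p → SymMat n := fun i => if ⟪a i, X⟫_ℝ = c i then a i else 0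
  let D : Set (SymMat n) := {d | P.A d = 0 ∧ ∀ i, ⟪a' i, d⟫_ℝ ≤ 0}
  have hDconv : Convex ℝ D := by
    rintro d ⟨hd1, hd2⟩ e ⟨he1, he2⟩ α β hα hβ -
    refine ⟨by simp [hd1, he1], fun i => ?_⟩
    rw [inner_add_right, inner_smul_right, inner_smul_right]
    exact add_nonpos (mul_nonpos_of_nonneg_of_nonpos hα (hd2 i))
      (mul_nonpos_of_nonneg_of_nonpos hβ (he2 i))
  have hd₀ : X₁ - X ∈ D := by
    refine ⟨by rw [map_sub, hAX₁, hX.1.1, sub_self], fun i => ?_⟩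
    by_cases h : ⟪a i, X⟫_ℝ = c i
    · simp only [a', h, if_true, inner_sub_right]
      linarith [hX₁K i]
    · simp [a', h]
  obtain ⟨S, hS1, hS2, hS3⟩ := exists_dual_cone_multiplier (g := P.Q X + P.C) convex_psdCone
    zero_mem_psdCone (fun t ht V hV => smul_mem_psdCone ht.le hV) hDconv
    ⟨map_zero _, fun i => by simp⟩ hX.1.2.1 hd₀
    (by rw [add_sub_cancel]; exact pdCone_subset_interior_psdCone hpd)
    (fun d hd hXd => inner_gradient_nonneg hX hK hd.1 (fun i hi => by
      have := hd.2 i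
      simpa only [a', hi, if_true] using this) hXd)
  obtain ⟨l, y, hl, hy⟩ := exists_sub_combination_mem_range_adjoint P.A a' (-(P.Q X + P.C - S))
    (fun d h1 h2 => by
      rw [inner_neg_left]
      exact neg_nonpos.2 (hS3 d ⟨h1, h2⟩))
  refine ⟨-∑ i, l i • a' i, S, -y, ⟨hX.1.2.2, fun V hV => ?_⟩, ⟨?_, fun V hV => ?_⟩, ?_⟩
  · have hVK : ∀ i, ⟪a i, V⟫_ℝ ≤ c i := by rw [hK] at hV; exact hV
    change 0 ≤ ⟪-∑ i, l i • a' i, V - X⟫_ℝ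
    rw [inner_neg_left, sum_inner, neg_nonneg]
    refine Finset.sum_nonpos fun i _ => ?_
    rw [real_inner_smul_left]
    refine mul_nonpos_of_nonneg_of_nonpos (hl i) ?_
    by_cases h : ⟪a i, X⟫_ℝ = c i
    · simp only [a', h, if_true, inner_sub_right]
      linarith [hVK i]
    · simp [a', h]
  · rw [mem_psdCone_iff]
    intro v
    rw [real_inner_comm]
    exact hS1 _ (outer_mem_psdCone v)
  · change 0 ≤ ⟪X, V - S⟫_ℝ
    rw [inner_sub_right, real_inner_comm S X, hS2, sub_zero]
    exact inner_nonneg_of_mem_psdCone hX.1.2.1 hV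
  · have h : P.Q X + P.C = S - -(P.Q X + P.C - S) := by abel
    rw [h, hy, map_neg, Aadj]
    abel

theorem exists_isKKT (hsol : P.primalSolutions.Nonempty) (hslater : P.SlaterCondition) :
    ∃ Z W S y X, (P.splitProblem hA hσ hτ hτ').IsKKT Z W S y X := by
  obtain ⟨X, hX⟩ := hsol
  obtain ⟨Z, S, y, hZ, hS, hgrad⟩ := exists_multipliers hslater hX
  obtain ⟨W, hW, V, hV, hWV⟩ :=
    (LinearMap.range P.Q).exists_add_mem_mem_orthogonal X
  have hQV : P.Q V = 0 := by
    rwa [P.Q_pos.isSymmetric.orthogonal_range, LinearMap.mem_ker] at hV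
  have hQ : P.Q W = P.Q X := by rw [hWV, map_add, hQV, add_zero]
  refine ⟨Z, W, S, y, X, hZ, hS, hW, hQ, hX.1.1, ?_⟩
  change P.residual Z W S y = 0
  rw [residual, hQ]
  have : Z - P.Q X + S + P.Aadj y - P.C = (Z + S + P.Aadj y) - (P.Q X + P.C) := by abel
  rw [this, ← hgrad, sub_self]

/-- Membership in `normalRel (psdCone n)` unfolds to complementarity and dual feasibility. -/
theorem psd_complementarity {X S : SymMat n} (h : (X, S) ∈ normalRel (psdCone n)) :
    ⟪S, X⟫_ℝ = 0 ∧ ∀ V ∈ psdCone n, 0 ≤ ⟪V, X⟫_ℝ := by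
  obtain ⟨h1, h2⟩ := h
  simp only at h1 h2
  have h0 := h2 0 zero_mem_psdCone
  have h3 := h2 ((2 : ℝ) • S) (smul_mem_psdCone zero_le_two h1)
  rw [zero_sub, inner_neg_right] at h0
  rw [inner_sub_right, inner_smul_right] at h3
  have h4 : ⟪X, S⟫_ℝ = 0 := by linarith
  refine ⟨by rw [real_inner_comm, h4], fun V hV => ?_⟩
  have h5 := h2 V hV
  rwa [inner_sub_right, h4, sub_zero, real_inner_comm] at h5

theorem inner_Q_polarization (X Y : SymMat n) :
    ⟪X - Y, P.Q (X - Y)⟫_ℝ = ⟪X, P.Q X⟫_ℝ - 2 * ⟪X, P.Q Y⟫_ℝ + ⟪Y, P.Q Y⟫_ℝ := by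
  have : ⟪Y, P.Q X⟫_ℝ = ⟪X, P.Q Y⟫_ℝ := by rw [← P.Q_pos.isSymmetric, real_inner_comm]
  simp only [map_sub, inner_sub_left, inner_sub_right, this]
  ring

theorem mem_primalSolutions_of_isKKT {Z W S X : SymMat n} {y : EuclideanSpace ℝ (Fin m)}
    (h : (P.splitProblem hA hσ hτ hτ').IsKKT Z W S y X) : X ∈ P.primalSolutions := by
  have hZ : (Z, X) ∈ normalRel P.K := h.mem₁
  obtain ⟨hSX, hX⟩ := psd_complementarity (show (X, S) ∈ normalRel (psdCone n) from h.mem₂)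
  have hAX : P.A X = P.b := h.A_eq
  have hQ : P.Q W = P.Q X := h.Q_eq
  have hres : P.residual Z W S y = 0 := h.res_eq
  have hpsd : X ∈ psdCone n := mem_psdCone_iff.2 fun v => hX _ (outer_mem_psdCone v)
  have hSpsd : S ∈ psdCone n := (show (X, S) ∈ normalRel (psdCone n) from h.mem₂).1
  refine ⟨⟨hAX, hpsd, hZ.1⟩, ?_⟩
  rintro X' ⟨hA', hpsd', hK'⟩
  have h1 := primalObj_add_smul (P := P) X (X' - X) 1
  rw [one_smul, add_sub_cancel] at h1
  have hgrad : P.Q X + P.C = Z + S + P.Aadj y := by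
    rw [residual, hQ, sub_eq_zero] at hres
    rw [← hres]; abel
  have h2 : 0 ≤ ⟪Z, X' - X⟫_ℝ := hZ.2 X' hK'
  have h3 : 0 ≤ ⟪S, X' - X⟫_ℝ := by
    rw [inner_sub_right, hSX, sub_zero]
    exact inner_nonneg_of_mem_psdCone hSpsd hpsd'
  have h4 : ⟪P.Aadj y, X' - X⟫_ℝ = 0 := by
    rw [Aadj, LinearMap.adjoint_inner_left, map_sub, hA', hAX, sub_self, inner_zero_right]
  rw [hgrad, inner_add_left, inner_add_left, h4] at h1
  have h5 := P.Q_pos.inner_nonneg_right (X' - X)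
  linarith

theorem mem_dualSolutions_of_isKKT {Z W S X : SymMat n} {y : EuclideanSpace ℝ (Fin m)}
    (h : (P.splitProblem hA hσ hτ hτ').IsKKT Z W S y X) : (Z, W, S, y) ∈ P.dualSolutions := by
  have hZ : (Z, X) ∈ normalRel P.K := h.mem₁
  obtain ⟨hSX, hX⟩ := psd_complementarity (show (X, S) ∈ normalRel (psdCone n) from h.mem₂)
  have hAX : P.A X = P.b := h.A_eq
  have hQ : P.Q W = P.Q X := h.Q_eq
  have hSpsd : S ∈ psdCone n := (show (X, S) ∈ normalRel (psdCone n) from h.mem₂).1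
  have hfeas : Z - P.Q W + S + P.Aadj y = P.C := sub_eq_zero.1 h.res_eq
  have hsupp : P.suppK (-Z) = ((⟪-Z, X⟫_ℝ : ℝ) : EReal) := fenchelConj_indicatorFn_neg_eq hZ
  have hobj : P.dualObj (Z, W, S, y) =
      ((⟪-Z, X⟫_ℝ + ((1 / 2) * ⟪W, P.Q W⟫_ℝ - ⟪P.b, y⟫_ℝ) : ℝ) : EReal) := by
    rw [dualObj, hsupp, ← EReal.coe_add]
  -- pairing dual feasibility with `X` expresses the linear part of the dual objective
  have hpair : ∀ {Z' W' S' : SymMat n} {y' : EuclideanSpace ℝ (Fin m)},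
      Z' - P.Q W' + S' + P.Aadj y' = P.C →
      ⟪-Z', X⟫_ℝ - ⟪P.b, y'⟫_ℝ = ⟪S', X⟫_ℝ - ⟪W', P.Q W⟫_ℝ - ⟪P.C, X⟫_ℝ := by
    intro Z' W' S' y' h'
    have h1 : ⟪P.Aadj y', X⟫_ℝ = ⟪P.b, y'⟫_ℝ := by
      rw [Aadj, LinearMap.adjoint_inner_left, hAX, real_inner_comm]
    have h2 : ⟪P.Q W', X⟫_ℝ = ⟪W', P.Q W⟫_ℝ := by rw [P.Q_pos.isSymmetric, hQ]
    rw [← h', inner_add_left, inner_add_left, inner_sub_left, h1, h2, inner_neg_left]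
    ring
  refine ⟨?_, ⟨hfeas, hSpsd, h.range⟩, isMinOn_iff.2 ?_⟩
  · rw [effDom, Set.mem_ofPred_eq, hobj]
    exact EReal.coe_lt_top _
  · rintro ⟨Z', W', S', y'⟩ ⟨hfeas', hS', -⟩
    have hle : ((⟪-Z', X⟫_ℝ : ℝ) : EReal) ≤ P.suppK (-Z') :=
      inner_le_fenchelConj_indicatorFn hZ.1 (-Z')
    rw [hobj]
    refine le_trans ?_ (add_le_add_left hle _)
    rw [← EReal.coe_add, EReal.coe_le_coe_iff]
    have e1 := hpair hfeas
    have e2 := hpair hfeas'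
    have e3 := hX S' hS'
    have e4 := P.Q_pos.inner_nonneg_right (W' - W)
    rw [inner_Q_polarization] at e4
    linarith

end QSDP

theorem mainTheorem2 {n m : ℕ} (P : QSDP n m)
    (hsol : P.primalSolutions.Nonempty) (hslater : P.SlaterCondition)
    (σ τ : ℝ) (hσ : 0 < σ) (hτ : 0 < τ) (hτ' : τ < (1 + √5) / 2)
    (ε : ℕ → ℝ) (hε : ∀ k, 0 ≤ ε k) (hεsum : Summable ε)
    (Z W S : ℕ → SymMat n) (y : ℕ → EuclideanSpace ℝ (Fin m)) (X : ℕ → SymMat n)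
    (hseq : P.IsPhaseISequence σ τ ε Z W S y X) :
    (∃ v ∈ P.dualSolutions, Tendsto (fun k => (Z k, W k, S k, y k)) atTop (𝓝 v)) ∧
    (∃ Xstar ∈ P.primalSolutions, Tendsto X atTop (𝓝 Xstar)) := by
  obtain ⟨L, -, hL⟩ := QSDP.exists_step_of_phaseIStep (P := P) (hA := hslater.surjective)
    (hσ := hσ) (hτ := hτ) (hτ' := hτ')
  -- finiteness of the objective persists, so that every subproblem is a genuine one
  have hdom : ∀ k, -Z k ∈ effDom P.suppK ∧ S k ∈ psdCone n := by
    intro k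
    induction k with
    | zero => exact ⟨hseq.init_Z, hseq.init_S⟩
    | succ k ih =>
      obtain ⟨h1, h2, -⟩ := hL ih.1 ih.2 (hseq.step k)
      exact ⟨h1, h2⟩
  obtain ⟨Zs, Ws, Ss, ys, Xs, hK, tZ, tW, tS, ty, tX⟩ :=
    SplitProblem.exists_isKKT_tendsto (hεsum.mul_left L)
      (fun k => (hL (hdom k).1 (hdom k).2 (hseq.step k)).2.2)
      (QSDP.exists_isKKT hsol hslater)
  exact ⟨⟨_, QSDP.mem_dualSolutions_of_isKKT hK,
    tZ.prodMk_nhds (tW.prodMk_nhds (tS.prodMk_nhds ty))⟩,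
    ⟨Xs, QSDP.mem_primalSolutions_of_isKKT hK, tX⟩⟩
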